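/- **Setting.** $\mu$ASM programs are finite sequences of labelled instructions (skip, assignment, load, store, indirect jump, `beqz`, conditional assignment, speculation barrier, call, return) with a function map and an entry line; values are $\mathbb N\cup\{\bot\}$. A configuration $\sigma=\langle m,a\rangle$ consists of a memory $m$ and a register file $a$ (including $\mathit{pc}$ and $\mathit{sp}$). It is initial if $\mathit{pc}$ is the entry line and final if $\mathit{pc}=\bot$. The small-step non-speculative semantics emits $\mathtt{load}\,n$, $\mathtt{store}\,n$, $\mathtt{pc}\,n$, $\mathtt{call}\,f$, $\mathtt{ret}\,n$; accessing memory at address $\bot$ is not possible (the configuration is stuck). For each semantics below, the *behaviour* of $p$ is the set of all traces generated from an initial configuration until termination. Write $B_{NS}(p)$ for the non-speculative behaviour. The non-speculative projection $\tau{\restriction}_{ns}$ deletes all sub-traces enclosed between $\mathtt{start}\,i$ and $\mathtt{rlb}\,i$. Fix a maximal speculation window $\omega\in\mathbb N$. The semantics Spec-S has three components. * *Always-mispredict (AM).* States are stacks of instances $\langle ctr,\sigma,n\rangle$ with a counter $ctr$ and a remaining window $n$ ($\bot$, treated as infinite, when not speculating); execution starts from a single instance $\langle 0,\sigma,\bot\rangle$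 and only the top instance steps. If the current instruction of $\langle ctr,\sigma,n+1\rangle$ is a store at line $k$ with $\sigma\xrightarrow{\tau}\sigma'$, the instance is replaced by $\langle ctr,\sigma',n\rangle$ with $\langle ctr+1,\sigma[\mathit{pc}\mapsto k+1],\min(\omega,n)\rangle$ pushed on top, emitting $\tau\cdot\mathtt{start}\,ctr\cdot\mathtt{skip}\,k$. Other instructions are executed non-speculatively and decrease the window by one; a barrier sets the window of a speculating instance to $0$. When the window of the top instance is $0$ or it is stuck, it is popped, emitting $\mathtt{rlb}\,ctr$ with the counter of the instance below, which takes over the popped instance's counter. * *Oracle.* An oracle $O$ maps the program, the history (the lines of the stores executed or bypassed so far on the current execution path, with these outcomes) and the line of a store either to "execute" or to "bypass with window $w$" for some $w\le\omega$. Executed stores are executed non-speculatively, without starting a transaction; a bypass pushes an instance as in the AM semantics, but with window $w$. Each step decreases the windows of all instances on the stack by one, and a barrier sets those of all speculating instances to $0$. When windows on the stack are $0$, or else when the top instance is stuck, a rollback occurs: the topmost instance with window $0$ (respectively, the stuck top instance) is deleted together with all instances above it, $\mathtt{rlb}$ is emitted with the counter of the instance below, and that instance continues, taking over the counter of the former top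 of the stack. * *Symbolic.* The AM rules over symbolic configurations (symbols for the initial memory and registers, concrete $\mathit{pc}$) and the symbolic non-speculative semantics, with path constraints recorded in the trace. For a set $S$ of symbolic traces, $\mathrm{conc}(S)$ is the set of all concrete traces obtained from members of $S$ by evaluating them under a valuation of the symbols that satisfies their path constraints. Write $B_S(p)$, $B_S^O(p)$ and $B_S^{sym}(p)$ for the AM behaviour, the behaviour under oracle $O$, and the symbolic behaviour. For a policy $P$ (public registers and public memory locations), $p$ satisfies *speculative non-interference* (SNI) with respect to a speculative semantics if, for any two initial configurations that agree on $P$ and generate terminating traces $\tau_1,\tau_2$ with $\tau_1{\restriction}_{ns}=\tau_2{\restriction}_{ns}$, we have $\tau_1=\tau_2$. **Theorem.** For every $\omega$, Spec-S is a secure speculative semantics, that is, for every program $p$: 1. *(Oracle overapproximation)* for every policy $P$: $p$ satisfies SNI with respect to the oracle semantics for all oracles $O$ if and only if $p$ satisfies SNI with respect to the AM semantics; 2. *(Symbolic consistency)* $B_S(p)=\mathrm{conc}(B_S^{sym}(p))$; 3. *(NS consistency)* $B_S(p){\restriction}_{ns}=B_{NS}(p)$, and $B_{NS}(p)=B_S^{O}(p){\restriction}_{ns}$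 for every oracle $O$. -/

import Mathlib

namespace MuAsm

/-! ## Syntax -/

/-- Values: natural numbers and the special value `⊥`, written `none`. -/
abbrev Val := Option ℕ

/-- Register identifiers: the program counter, the stack pointer, and the other registers. -/
inductive Reg where
  | pc
  | sp
  | gp (i : ℕ)
  deriving DecidableEq

/-- Function names. -/
abbrev FName := String

/-- Expressions; an operator is given by its meaning, an arbitrary function on values. -/
inductive Expr where
  | lit (v : Val)
  | reg (x : Reg)
  | un (f : Val → Val) (e : Expr)
  | bin (f : Val → Val → Val) (e₁ e₂ : Expr)

/-- Instructions. -/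
inductive Instr where
  | skip
  | assign (x : Reg) (e : Expr)
  | load (x : Reg) (e : Expr)
  | store (x : Reg) (e : Expr)
  | jmp (e : Expr)
  | beqz (x : Reg) (l : Val)
  /-- `condAssign x e c` assigns `e` to `x` when `c` evaluates to `0`. -/
  | condAssign (x : Reg) (e c : Expr)
  | spbarr
  | call (f : FName)
  | ret

/-- A program: a finite sequence of labelled instructions, the function map, and the label of
the instruction at which execution starts. -/
structure Program where
  code : List (ℕ × Instr)
  funs : List (FName × ℕ)
  entry : ℕ

/-- The instruction at a given value of the program counter (`none`: there is none). -/
def Program.at (p : Program) (v : Val) : Option Instr :=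
  v.bind fun n => p.code.lookup n

/-- The starting line of a function. -/
def Program.fn (p : Program) (f : FName) : Option ℕ :=
  p.funs.lookup f

/-! ## Observations and traces -/

inductive Obs where
  | load (n : Val)
  | store (n : Val)
  | pc (n : Val)
  | call (f : FName)
  | ret (n : Val)
  | start (id : ℕ)
  | rollback (id : ℕ)
  | skip (n : ℕ)

/-- Traces; the empty observation is not recorded. -/
abbrev Trace := List Obs

/-- Scan a trace; `some n` records that we are inside the speculative transaction opened by an
outermost `start n`, and everything is dropped up to and including `rollback n`. -/
def nspecAux : Option ℕ → Trace → Trace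
  | _, [] => []
  | none, .start n :: t => nspecAux (some n) t
  | none, o :: t => o :: nspecAux none t
  | some n, .rollback m :: t => if m = n then nspecAux none t else nspecAux (some n) t
  | some n, _ :: t => nspecAux (some n) t

/-- The non-speculative projection: remove all sub-traces enclosed between `start n` and
`rollback n`. -/
def nspecProject (t : Trace) : Trace := nspecAux none t

/-! ## Labelled reflexive-transitive closure -/

inductive Steps {S O : Type} (R : S → List O → S → Prop) : S → List O → S → Prop where
  | refl (s : S) : Steps R s [] s
  | head {s s' s'' : S} {τ τ' : List O} : R s τ s' → Steps R s' τ' s'' → Steps R s (τ ++ τ') s''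

/-! ## Non-speculative semantics -/

/-- Register files. -/
abbrev RegFile := Reg → Val

/-- Configurations: a memory and a register file. -/
structure Config where
  mem : ℕ → Val
  regs : RegFile

def Expr.eval (a : RegFile) : Expr → Val
  | .lit v => v
  | .reg x => a x
  | .un f e => f (e.eval a)
  | .bin f e₁ e₂ => f (e₁.eval a) (e₂.eval a)

/-- `v + 8`. -/
def addEight : Val → Val
  | some k => some (k + 8)
  | none => none

/-- `v - 8`, which is `⊥` when the difference is not a natural number. -/
def subEight : Val → Val
  | some k => if 8 ≤ k then some (k - 8) else none
  | none => none

/-- Update of the program counter. -/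
def setPc (a : RegFile) (v : Val) : RegFile := Function.update a .pc v

/-- The non-speculative step relation. Addresses are natural numbers, so accessing memory at `⊥`
is not possible, and the program counter cannot be assigned directly. -/
inductive NSStep (p : Program) : Config → Trace → Config → Prop where
  | skip {m : ℕ → Val} {a : RegFile} {k : ℕ} :
      a .pc = some k → p.at (some k) = some .skip →
      NSStep p ⟨m, a⟩ [] ⟨m, setPc a (some (k + 1))⟩
  | spbarr {m : ℕ → Val} {a : RegFile} {k : ℕ} :
      a .pc = some k → p.at (some k) = some .spbarr →
      NSStep p ⟨m, a⟩ [] ⟨m, setPc a (some (k + 1))⟩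
  | assign {m : ℕ → Val} {a : RegFile} {k : ℕ} {x : Reg} {e : Expr} :
      a .pc = some k → p.at (some k) = some (.assign x e) → x ≠ .pc →
      NSStep p ⟨m, a⟩ [] ⟨m, Function.update (setPc a (some (k + 1))) x (e.eval a)⟩
  | condAssignSat {m : ℕ → Val} {a : RegFile} {k : ℕ} {x : Reg} {e c : Expr} :
      a .pc = some k → p.at (some k) = some (.condAssign x e c) → x ≠ .pc →
      c.eval a = some 0 →
      NSStep p ⟨m, a⟩ [] ⟨m, Function.update (setPc a (some (k + 1))) x (e.eval a)⟩
  | condAssignUnsat {m : ℕ → Val} {a : RegFile} {k : ℕ} {x : Reg} {e c : Expr} :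
      a .pc = some k → p.at (some k) = some (.condAssign x e c) → x ≠ .pc →
      c.eval a ≠ some 0 →
      NSStep p ⟨m, a⟩ [] ⟨m, setPc a (some (k + 1))⟩
  | load {m : ℕ → Val} {a : RegFile} {k : ℕ} {x : Reg} {e : Expr} {n : ℕ} :
      a .pc = some k → p.at (some k) = some (.load x e) → x ≠ .pc → e.eval a = some n →
      NSStep p ⟨m, a⟩ [.load (some n)]
        ⟨m, Function.update (setPc a (some (k + 1))) x (m n)⟩
  | store {m : ℕ → Val} {a : RegFile} {k : ℕ} {x : Reg} {e : Expr} {n : ℕ} :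
      a .pc = some k → p.at (some k) = some (.store x e) → e.eval a = some n →
      NSStep p ⟨m, a⟩ [.store (some n)]
        ⟨Function.update m n (a x), setPc a (some (k + 1))⟩
  | jmp {m : ℕ → Val} {a : RegFile} {k : ℕ} {e : Expr} :
      a .pc = some k → p.at (some k) = some (.jmp e) →
      NSStep p ⟨m, a⟩ [.pc (e.eval a)] ⟨m, setPc a (e.eval a)⟩
  | beqzSat {m : ℕ → Val} {a : RegFile} {k : ℕ} {x : Reg} {l : Val} :
      a .pc = some k → p.at (some k) = some (.beqz x l) → a x = some 0 →
      NSStep p ⟨m, a⟩ [.pc l] ⟨m, setPc a l⟩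
  | beqzUnsat {m : ℕ → Val} {a : RegFile} {k : ℕ} {x : Reg} {l : Val} :
      a .pc = some k → p.at (some k) = some (.beqz x l) → a x ≠ some 0 →
      NSStep p ⟨m, a⟩ [.pc (some (k + 1))] ⟨m, setPc a (some (k + 1))⟩
  | call {m : ℕ → Val} {a : RegFile} {k : ℕ} {f : FName} {l n : ℕ} :
      a .pc = some k → p.at (some k) = some (.call f) → p.fn f = some l →
      subEight (a .sp) = some n →
      NSStep p ⟨m, a⟩ [.call f]
        ⟨Function.update m n (some (k + 1)), Function.update (setPc a (some l)) .sp (some n)⟩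
  | ret {m : ℕ → Val} {a : RegFile} {k n : ℕ} :
      a .pc = some k → p.at (some k) = some .ret → a .sp = some n →
      NSStep p ⟨m, a⟩ [.ret (m n)]
        ⟨m, Function.update (setPc a (m n)) .sp (addEight (a .sp))⟩
  /-- No instruction is left at the program counter: the program terminates. -/
  | terminate {m : ℕ → Val} {a : RegFile} {k : ℕ} :
      a .pc = some k → p.at (some k) = none →
      NSStep p ⟨m, a⟩ [] ⟨m, setPc a none⟩

/-- No non-speculative step is possible (this includes terminated configurations). -/
def Stuck (p : Program) (σ : Config) : Prop := ¬ ∃ τ σ', NSStep p σ τ σ'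

def Config.IsInitial (p : Program) (σ : Config) : Prop := σ.regs .pc = some p.entry

def Config.IsFinal (σ : Config) : Prop := σ.regs .pc = none

/-- `p` generates `τ` from `σ`, until termination, under the non-speculative semantics. -/
def nsGen (p : Program) (σ : Config) (τ : Trace) : Prop :=
  ∃ σ', Steps (NSStep p) σ τ σ' ∧ σ'.IsFinal

/-! ## Behaviours and speculative non-interference -/

/-- The behaviour of `p`: all traces generated from an initial configuration until termination,
where `gen p σ τ` says that `p` generates `τ` from `σ`. -/
def behaviour (gen : Program → Config → Trace → Prop) (p : Program) : Set Trace :=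
  {τ | ∃ σ : Config, σ.IsInitial p ∧ gen p σ τ}

/-- Policies: the public registers and the public memory locations. -/
structure Policy where
  regs : Set Reg
  mem : Set ℕ

def LowEquiv (pol : Policy) (σ₁ σ₂ : Config) : Prop :=
  (∀ x ∈ pol.regs, σ₁.regs x = σ₂.regs x) ∧ ∀ n ∈ pol.mem, σ₁.mem n = σ₂.mem n

/-- Speculative non-interference of `p` for a policy and a speculative semantics. -/
def SNI (gen : Program → Config → Trace → Prop) (pol : Policy) (p : Program) : Prop :=
  ∀ σ₁ σ₂ : Config, σ₁.IsInitial p → σ₂.IsInitial p → LowEquiv pol σ₁ σ₂ →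
    ∀ τ₁ τ₂ : Trace, gen p σ₁ τ₁ → gen p σ₂ τ₂ →
      nspecProject τ₁ = nspecProject τ₂ → τ₁ = τ₂

/-! ## Always-mispredict semantics for store bypasses -/

/-- Skipping the instruction at line `k`: only the program counter changes. -/
def Config.skipAt (σ : Config) (k : ℕ) : Config := ⟨σ.mem, setPc σ.regs (some (k + 1))⟩

/-- Speculative instances: counter, configuration and remaining speculation window; the window is
`⊤` when no speculation is happening. -/
structure Inst where
  ctr : ℕ
  conf : Config
  win : ℕ∞

/-- Always-mispredict steps on stacks of instances; the head of the list is the top. Every store is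
executed in the current instance and bypassed in a new instance pushed on top of it. -/
inductive AMStep (ω : ℕ) (p : Program) : List Inst → Trace → List Inst → Prop where
  | store {c k : ℕ} {σ σ' : Config} {n : ℕ∞} {x : Reg} {e : Expr} {τ : Trace}
      {rest : List Inst} :
      σ.regs .pc = some k → p.at (some k) = some (.store x e) → NSStep p σ τ σ' →
      AMStep ω p (⟨c, σ, n + 1⟩ :: rest) (τ ++ [.start c, .skip k])
        (⟨c + 1, σ.skipAt k, min (ω : ℕ∞) n⟩ :: ⟨c, σ', n⟩ :: rest)
  | noSpec {c : ℕ} {σ σ' : Config} {n : ℕ∞} {τ : Trace} {rest : List Inst} :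
      (∀ x e, p.at (σ.regs .pc) ≠ some (.store x e)) → p.at (σ.regs .pc) ≠ some .spbarr →
      NSStep p σ τ σ' →
      AMStep ω p (⟨c, σ, n + 1⟩ :: rest) τ (⟨c, σ', n⟩ :: rest)
  /-- A barrier has no effect outside of speculation. -/
  | barrier {c : ℕ} {σ σ' : Config} {τ : Trace} {rest : List Inst} :
      p.at (σ.regs .pc) = some .spbarr → NSStep p σ τ σ' →
      AMStep ω p (⟨c, σ, ⊤⟩ :: rest) τ (⟨c, σ', ⊤⟩ :: rest)
  /-- A barrier uses up the speculation window of a speculating instance. -/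
  | barrierSpec {c n : ℕ} {σ σ' : Config} {τ : Trace} {rest : List Inst} :
      p.at (σ.regs .pc) = some .spbarr → NSStep p σ τ σ' →
      AMStep ω p (⟨c, σ, (n : ℕ∞) + 1⟩ :: rest) τ (⟨c, σ', 0⟩ :: rest)
  | rollback {c c' : ℕ} {σ σ' : Config} {n n' : ℕ∞} {rest : List Inst} :
      n' = 0 ∨ Stuck p σ' →
      AMStep ω p (⟨c', σ', n'⟩ :: ⟨c, σ, n⟩ :: rest) [.rollback c] (⟨c', σ, n⟩ :: rest)

def amGen (ω : ℕ) (p : Program) (σ : Config) (τ : Trace) : Prop :=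
  ∃ c σ', Steps (AMStep ω p) [⟨0, σ, ⊤⟩] τ [⟨c, σ', ⊤⟩] ∧ σ'.IsFinal

/-! ## Oracle semantics for store bypasses -/

/-- Prediction history: for every store on the execution path of an instance, its line and whether
it was bypassed. -/
abbrev History := List (ℕ × Bool)

/-- Oracles: from the program, the history and the line of a store, predict that the store is
executed (`none`) or that it is bypassed (`some w`), with speculation window `w ≤ ω`. -/
abbrev Oracle (ω : ℕ) := Program → History → ℕ → Option (Fin (ω + 1))

/-- Instances of the oracle semantics. -/
structure OInst where
  ctr : ℕ
  conf : Config
  hist : History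
  win : ℕ∞

/-- One step passes: all windows decrease by one (and `⊤ - 1 = ⊤`). -/
def OInst.decr (ψ : OInst) : OInst := { ψ with win := ψ.win - 1 }

/-- A barrier uses up every speculation window. -/
def OInst.zero (ψ : OInst) : OInst := { ψ with win := if ψ.win = ⊤ then ⊤ else 0 }

/-- No speculation window on the stack has been used up. -/
def Enabled (Ψ : List OInst) : Prop := ∀ ψ ∈ Ψ, ψ.win ≠ 0

/-- Oracle steps on stacks of instances; the head of the list is the top. -/
inductive OStep (ω : ℕ) (O : Oracle ω) (p : Program) :
    List OInst → Trace → List OInst → Prop where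
  | storeSkip {c k : ℕ} {σ σ' : Config} {h : History} {n : ℕ∞} {w : Fin (ω + 1)} {x : Reg}
      {e : Expr} {τ : Trace} {rest : List OInst} :
      Enabled (⟨c, σ, h, n⟩ :: rest) →
      σ.regs .pc = some k → p.at (some k) = some (.store x e) → NSStep p σ τ σ' →
      O p h k = some w →
      OStep ω O p (⟨c, σ, h, n⟩ :: rest) (τ ++ [.start c, .skip k])
        (⟨c + 1, σ.skipAt k, h ++ [(k, true)], ((w : ℕ) : ℕ∞)⟩ ::
          ⟨c, σ', h ++ [(k, false)], n - 1⟩ :: rest.map OInst.decr)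
  | storeExec {c k : ℕ} {σ σ' : Config} {h : History} {n : ℕ∞} {x : Reg}
      {e : Expr} {τ : Trace} {rest : List OInst} :
      Enabled (⟨c, σ, h, n⟩ :: rest) →
      σ.regs .pc = some k → p.at (some k) = some (.store x e) → NSStep p σ τ σ' →
      O p h k = none →
      OStep ω O p (⟨c, σ, h, n⟩ :: rest) τ
        (⟨c, σ', h ++ [(k, false)], n - 1⟩ :: rest.map OInst.decr)
  | noSpec {c : ℕ} {σ σ' : Config} {h : History} {n : ℕ∞} {τ : Trace} {rest : List OInst} :
      Enabled (⟨c, σ, h, n⟩ :: rest) →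
      (∀ x e, p.at (σ.regs .pc) ≠ some (.store x e)) → p.at (σ.regs .pc) ≠ some .spbarr →
      NSStep p σ τ σ' →
      OStep ω O p (⟨c, σ, h, n⟩ :: rest) τ (⟨c, σ', h, n - 1⟩ :: rest.map OInst.decr)
  | barrier {c : ℕ} {σ σ' : Config} {h : History} {n : ℕ∞} {τ : Trace} {rest : List OInst} :
      Enabled (⟨c, σ, h, n⟩ :: rest) →
      p.at (σ.regs .pc) = some .spbarr → NSStep p σ τ σ' →
      OStep ω O p (⟨c, σ, h, n⟩ :: rest) τ
        (OInst.zero ⟨c, σ', h, n⟩ :: rest.map OInst.zero)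
  /-- The window of an instance `ψ'` anywhere on the stack is used up: `ψ'` and all instances
  `above` it are deleted, and the instance `ψ` below it, in which the store was executed, goes on
  with the current (topmost) counter. If several windows are used up, the topmost one comes
  first. -/
  | rollback {above rest : List OInst} {ψ' ψ top : OInst} :
      Enabled above → ψ'.win = 0 → (above ++ [ψ']).head? = some top →
      OStep ω O p (above ++ ψ' :: ψ :: rest) [.rollback ψ.ctr]
        ({ ψ with ctr := top.ctr } :: rest)
  /-- The topmost instance cannot proceed. -/
  | rollbackStuck {rest : List OInst} {ψ' ψ : OInst} :
      Enabled (ψ' :: ψ :: rest) → Stuck p ψ'.conf →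
      OStep ω O p (ψ' :: ψ :: rest) [.rollback ψ.ctr] ({ ψ with ctr := ψ'.ctr } :: rest)

def oracleGen (ω : ℕ) (O : Oracle ω) (p : Program) (σ : Config) (τ : Trace) : Prop :=
  ∃ c σ' h, Steps (OStep ω O p) [⟨0, σ, [], ⊤⟩] τ [⟨c, σ', h, ⊤⟩] ∧ σ'.IsFinal

/-! ## Symbolic expressions and symbolic traces -/

mutual
/-- Symbolic expressions; `sym x` is the symbol for the initial value of register `x`, and
`ite c e e'` is `e` if `c` is `0`, and `e'` otherwise. -/
inductive SymExpr where
  | const (v : Val)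
  | sym (x : Reg)
  | un (f : Val → Val) (e : SymExpr)
  | bin (f : Val → Val → Val) (e₁ e₂ : SymExpr)
  | ite (c e e' : SymExpr)
  | read (m : SymMem) (addr : SymExpr)
/-- Symbolic memories; `init` is the symbol for the initial memory. -/
inductive SymMem where
  | init
  | write (m : SymMem) (addr v : SymExpr)
end

/-- Valuations of the symbols. -/
structure Valuation where
  mem : ℕ → Val
  reg : Reg → Val

mutual
def SymExpr.eval (μ : Valuation) : SymExpr → Val
  | .const v => v
  | .sym x => μ.reg x
  | .un f e => f (e.eval μ)
  | .bin f e₁ e₂ => f (e₁.eval μ) (e₂.eval μ)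
  | .ite c e e' => if c.eval μ = some 0 then e.eval μ else e'.eval μ
  | .read m e =>
    match e.eval μ with
    | some n => m.eval μ n
    | none => none
def SymMem.eval (μ : Valuation) : SymMem → ℕ → Val
  | .init => μ.mem
  | .write m e v =>
    match e.eval μ with
    | some n => Function.update (m.eval μ) n (v.eval μ)
    | none => m.eval μ
end

/-- Path constraints `e = v` and `e ≠ v`. -/
inductive PathCond where
  | eq (e : SymExpr) (v : Val)
  | ne (e : SymExpr) (v : Val)

def PathCond.Holds (μ : Valuation) : PathCond → Prop
  | .eq e v => e.eval μ = v
  | .ne e v => e.eval μ ≠ v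

/-- Symbolic observations, among them path constraints `symPc φ`. -/
inductive SymObs where
  | symPc (φ : PathCond)
  | load (e : SymExpr)
  | store (e : SymExpr)
  | pc (n : Val)
  | call (f : FName)
  | ret (n : Val)
  | start (id : ℕ)
  | rollback (id : ℕ)
  | skip (n : ℕ)

abbrev SymTrace := List SymObs

/-- A valuation satisfies the path condition of a symbolic trace. -/
def PathSat (μ : Valuation) (t : SymTrace) : Prop := ∀ φ, SymObs.symPc φ ∈ t → φ.Holds μ

/-- Concretization of an observation; path constraints are not observed. -/
def SymObs.eval (μ : Valuation) : SymObs → Option Obs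
  | .symPc _ => none
  | .load e => some (.load (e.eval μ))
  | .store e => some (.store (e.eval μ))
  | .pc n => some (.pc n)
  | .call f => some (.call f)
  | .ret n => some (.ret n)
  | .start n => some (.start n)
  | .rollback n => some (.rollback n)
  | .skip n => some (.skip n)

/-- All concrete traces obtained from the symbolic traces in `B` by valuations that are consistent
with their path conditions. -/
def concretize (B : Set SymTrace) : Set Trace :=
  {τ | ∃ t ∈ B, ∃ μ : Valuation, PathSat μ t ∧ τ = t.filterMap (SymObs.eval μ)}

/-! ## Symbolic non-speculative semantics -/

abbrev SymRegFile := Reg → SymExpr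

/-- Symbolic configurations. The program counter will always be a constant. -/
structure SymConfig where
  mem : SymMem
  regs : SymRegFile

def Expr.symEval (a : SymRegFile) : Expr → SymExpr
  | .lit v => .const v
  | .reg x => a x
  | .un f e => .un f (e.symEval a)
  | .bin f e₁ e₂ => .bin f (e₁.symEval a) (e₂.symEval a)

def symSetPc (a : SymRegFile) (v : Val) : SymRegFile := Function.update a .pc (.const v)

inductive SymStep (p : Program) : SymConfig → SymTrace → SymConfig → Prop where
  | skip {m : SymMem} {a : SymRegFile} {k : ℕ} :
      a .pc = .const (some k) → p.at (some k) = some .skip →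
      SymStep p ⟨m, a⟩ [] ⟨m, symSetPc a (some (k + 1))⟩
  | spbarr {m : SymMem} {a : SymRegFile} {k : ℕ} :
      a .pc = .const (some k) → p.at (some k) = some .spbarr →
      SymStep p ⟨m, a⟩ [] ⟨m, symSetPc a (some (k + 1))⟩
  | assign {m : SymMem} {a : SymRegFile} {k : ℕ} {x : Reg} {e : Expr} :
      a .pc = .const (some k) → p.at (some k) = some (.assign x e) → x ≠ .pc →
      SymStep p ⟨m, a⟩ []
        ⟨m, Function.update (symSetPc a (some (k + 1))) x (e.symEval a)⟩
  | condAssign {m : SymMem} {a : SymRegFile} {k : ℕ} {x : Reg} {e c : Expr} :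
      a .pc = .const (some k) → p.at (some k) = some (.condAssign x e c) → x ≠ .pc →
      SymStep p ⟨m, a⟩ []
        ⟨m, Function.update (symSetPc a (some (k + 1))) x
          (.ite (c.symEval a) (e.symEval a) (a x))⟩
  | load {m : SymMem} {a : SymRegFile} {k : ℕ} {x : Reg} {e : Expr} :
      a .pc = .const (some k) → p.at (some k) = some (.load x e) → x ≠ .pc →
      SymStep p ⟨m, a⟩ [.symPc (.ne (e.symEval a) none), .load (e.symEval a)]
        ⟨m, Function.update (symSetPc a (some (k + 1))) x (.read m (e.symEval a))⟩
  | store {m : SymMem} {a : SymRegFile} {k : ℕ} {x : Reg} {e : Expr} :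
      a .pc = .const (some k) → p.at (some k) = some (.store x e) →
      SymStep p ⟨m, a⟩ [.symPc (.ne (e.symEval a) none), .store (e.symEval a)]
        ⟨.write m (e.symEval a) (a x), symSetPc a (some (k + 1))⟩
  | jmp {m : SymMem} {a : SymRegFile} {k : ℕ} {e : Expr} (l : Val) :
      a .pc = .const (some k) → p.at (some k) = some (.jmp e) →
      SymStep p ⟨m, a⟩ [.symPc (.eq (e.symEval a) l), .pc l] ⟨m, symSetPc a l⟩
  | beqzSat {m : SymMem} {a : SymRegFile} {k : ℕ} {x : Reg} {l : Val} :
      a .pc = .const (some k) → p.at (some k) = some (.beqz x l) →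
      SymStep p ⟨m, a⟩ [.symPc (.eq (a x) (some 0)), .pc l] ⟨m, symSetPc a l⟩
  | beqzUnsat {m : SymMem} {a : SymRegFile} {k : ℕ} {x : Reg} {l : Val} :
      a .pc = .const (some k) → p.at (some k) = some (.beqz x l) →
      SymStep p ⟨m, a⟩ [.symPc (.ne (a x) (some 0)), .pc (some (k + 1))]
        ⟨m, symSetPc a (some (k + 1))⟩
  | call {m : SymMem} {a : SymRegFile} {k : ℕ} {f : FName} {l : ℕ} :
      a .pc = .const (some k) → p.at (some k) = some (.call f) → p.fn f = some l →
      SymStep p ⟨m, a⟩ [.symPc (.ne (.un subEight (a .sp)) none), .call f]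
        ⟨.write m (.un subEight (a .sp)) (.const (some (k + 1))),
          Function.update (symSetPc a (some l)) .sp (.un subEight (a .sp))⟩
  | ret {m : SymMem} {a : SymRegFile} {k : ℕ} (l : Val) :
      a .pc = .const (some k) → p.at (some k) = some .ret →
      SymStep p ⟨m, a⟩
        [.symPc (.ne (a .sp) none), .symPc (.eq (.read m (a .sp)) l), .ret l]
        ⟨m, Function.update (symSetPc a l) .sp (.un addEight (a .sp))⟩
  | terminate {m : SymMem} {a : SymRegFile} {k : ℕ} :
      a .pc = .const (some k) → p.at (some k) = none →
      SymStep p ⟨m, a⟩ [] ⟨m, symSetPc a none⟩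

/-- `SymStuck p σ t`: under the path constraints in `t`, no non-speculative step is possible. -/
inductive SymStuck (p : Program) : SymConfig → SymTrace → Prop where
  | final {m : SymMem} {a : SymRegFile} : a .pc = .const none → SymStuck p ⟨m, a⟩ []
  | assign {m : SymMem} {a : SymRegFile} {k : ℕ} {e : Expr} :
      a .pc = .const (some k) → p.at (some k) = some (.assign .pc e) → SymStuck p ⟨m, a⟩ []
  | condAssign {m : SymMem} {a : SymRegFile} {k : ℕ} {e c : Expr} :
      a .pc = .const (some k) → p.at (some k) = some (.condAssign .pc e c) →
      SymStuck p ⟨m, a⟩ []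
  | loadPc {m : SymMem} {a : SymRegFile} {k : ℕ} {e : Expr} :
      a .pc = .const (some k) → p.at (some k) = some (.load .pc e) → SymStuck p ⟨m, a⟩ []
  | load {m : SymMem} {a : SymRegFile} {k : ℕ} {x : Reg} {e : Expr} :
      a .pc = .const (some k) → p.at (some k) = some (.load x e) →
      SymStuck p ⟨m, a⟩ [.symPc (.eq (e.symEval a) none)]
  | store {m : SymMem} {a : SymRegFile} {k : ℕ} {x : Reg} {e : Expr} :
      a .pc = .const (some k) → p.at (some k) = some (.store x e) →
      SymStuck p ⟨m, a⟩ [.symPc (.eq (e.symEval a) none)]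
  | callUndef {m : SymMem} {a : SymRegFile} {k : ℕ} {f : FName} :
      a .pc = .const (some k) → p.at (some k) = some (.call f) → p.fn f = none →
      SymStuck p ⟨m, a⟩ []
  | call {m : SymMem} {a : SymRegFile} {k : ℕ} {f : FName} :
      a .pc = .const (some k) → p.at (some k) = some (.call f) →
      SymStuck p ⟨m, a⟩ [.symPc (.eq (.un subEight (a .sp)) none)]
  | ret {m : SymMem} {a : SymRegFile} {k : ℕ} :
      a .pc = .const (some k) → p.at (some k) = some .ret →
      SymStuck p ⟨m, a⟩ [.symPc (.eq (a .sp) none)]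

/-- The initial symbolic configuration: all registers but the program counter, and the memory,
are symbols. -/
def symInit (p : Program) : SymConfig := ⟨.init, symSetPc SymExpr.sym (some p.entry)⟩

def SymConfig.IsFinal (σ : SymConfig) : Prop := σ.regs .pc = .const none

/-! ## Symbolic semantics for store bypasses -/

def SymConfig.skipAt (σ : SymConfig) (k : ℕ) : SymConfig :=
  ⟨σ.mem, symSetPc σ.regs (some (k + 1))⟩

structure SymInst where
  ctr : ℕ
  conf : SymConfig
  win : ℕ∞

/-- The always-mispredict rules over symbolic configurations. -/
inductive SymAMStep (ω : ℕ) (p : Program) : List SymInst → SymTrace → List SymInst → Prop where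
  | store {c k : ℕ} {σ σ' : SymConfig} {n : ℕ∞} {x : Reg} {e : Expr} {τ : SymTrace}
      {rest : List SymInst} :
      σ.regs .pc = .const (some k) → p.at (some k) = some (.store x e) → SymStep p σ τ σ' →
      SymAMStep ω p (⟨c, σ, n + 1⟩ :: rest) (τ ++ [.start c, .skip k])
        (⟨c + 1, σ.skipAt k, min (ω : ℕ∞) n⟩ :: ⟨c, σ', n⟩ :: rest)
  | noSpec {c : ℕ} {σ σ' : SymConfig} {v : Val} {n : ℕ∞} {τ : SymTrace} {rest : List SymInst} :
      σ.regs .pc = .const v →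
      (∀ x e, p.at v ≠ some (.store x e)) → p.at v ≠ some .spbarr → SymStep p σ τ σ' →
      SymAMStep ω p (⟨c, σ, n + 1⟩ :: rest) τ (⟨c, σ', n⟩ :: rest)
  | barrier {c : ℕ} {σ σ' : SymConfig} {v : Val} {τ : SymTrace} {rest : List SymInst} :
      σ.regs .pc = .const v → p.at v = some .spbarr → SymStep p σ τ σ' →
      SymAMStep ω p (⟨c, σ, ⊤⟩ :: rest) τ (⟨c, σ', ⊤⟩ :: rest)
  | barrierSpec {c n : ℕ} {σ σ' : SymConfig} {v : Val} {τ : SymTrace} {rest : List SymInst} :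
      σ.regs .pc = .const v → p.at v = some .spbarr → SymStep p σ τ σ' →
      SymAMStep ω p (⟨c, σ, (n : ℕ∞) + 1⟩ :: rest) τ (⟨c, σ', 0⟩ :: rest)
  | rollback {c c' : ℕ} {σ σ' : SymConfig} {n : ℕ∞} {rest : List SymInst} :
      SymAMStep ω p (⟨c', σ', 0⟩ :: ⟨c, σ, n⟩ :: rest) [.rollback c] (⟨c', σ, n⟩ :: rest)
  | rollbackStuck {c c' : ℕ} {σ σ' : SymConfig} {n n' : ℕ∞} {τ : SymTrace}
      {rest : List SymInst} :
      SymStuck p σ' τ →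
      SymAMStep ω p (⟨c', σ', n'⟩ :: ⟨c, σ, n⟩ :: rest) (τ ++ [.rollback c])
        (⟨c', σ, n⟩ :: rest)

/-- The symbolic behaviour of `p`. -/
def symBehaviour (ω : ℕ) (p : Program) : Set SymTrace :=
  {τ | ∃ c σ', Steps (SymAMStep ω p) [⟨0, symInit p, ⊤⟩] τ [⟨c, σ', ⊤⟩] ∧ σ'.IsFinal}

/-! ## Secure speculative semantics -/

/-- A speculative semantics has an always-mispredict, an oracle and a symbolic component. -/
structure SpecSemantics where
  /-- `am p σ τ`: `p` generates `τ` from `σ` under the always-mispredict semantics. -/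
  am : Program → Config → Trace → Prop
  /-- The prediction oracles. -/
  Oracles : Type
  /-- `oracle O p σ τ`: `p` generates `τ` from `σ` under the semantics with oracle `O`. -/
  oracle : Oracles → Program → Config → Trace → Prop
  /-- The symbolic behaviour of a program. -/
  symbolic : Program → Set SymTrace

/-- Oracle overapproximation, symbolic consistency, and non-speculative consistency. -/
def SpecSemantics.Secure (X : SpecSemantics) : Prop :=
  (∀ (p : Program) (pol : Policy), (∀ O : X.Oracles, SNI (X.oracle O) pol p) ↔ SNI X.am pol p) ∧
  (∀ p : Program, behaviour X.am p = concretize (X.symbolic p)) ∧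
  (∀ p : Program, nspecProject '' behaviour X.am p = behaviour nsGen p ∧
    ∀ O : X.Oracles, behaviour nsGen p = nspecProject '' behaviour (X.oracle O) p)

/-- The speculative semantics for store bypasses with maximal speculation window `ω`. -/
def specS (ω : ℕ) : SpecSemantics where
  am := amGen ω
  Oracles := Oracle ω
  oracle := oracleGen ω
  symbolic := symBehaviour ω

end MuAsm

namespace MuAsm

/-! ## Runs of deterministic relations -/

-- Part 1 rests on the relation `Agree`, which mentions neither stacks nor counters. With a given
-- window, consider the tree of executions in which every store is both executed and bypassed; two
-- configurations agree if both trees are finite, with the same control flow and the same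
-- observations. For either speculative semantics, SNI says that low-equivalent initial
-- configurations with the same terminating non-speculative trace agree with window `⊤`. The pairs
-- to be compared are the same in both semantics: a speculative trace projects to the
-- non-speculative one, which is unique, and a terminating non-speculative run extends to a
-- terminating speculative run because each transaction is bounded by its window (`exists_amGen`,
-- `exists_oracleGen`).
--
-- The always-mispredict stack traverses the whole tree depth first. Equal traces force agreement
-- (`agree_of_amGen`), since every data-dependent jump is observed and so equal traces keep both
-- runs at equal lines; conversely agreement transports a run (`amGen.agree`).
--
-- An oracle run explores only part of the tree, with windows that are no larger once the windows
-- further down the stack are taken into account. Since `Agree` is monotone in the window, agreement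
-- makes the runs under each oracle equal (`oracleGen.agree`). For the converse no single oracle
-- need suffice, as a bypass also uses up the windows of the suspended instances. But each node of
-- the tree is reached, without any rollback, by an oracle that bypasses with window `ω` exactly
-- where the path to the node does. Quantifying over all oracles recovers agreement node by node
-- (`Agree.of_oIndist`).
--
-- Part 2 is a simulation in both directions: symbolic steps whose constraints hold evaluate to
-- concrete steps, and concrete steps lift to symbolic ones. For part 3, counters increase strictly
-- up the stack, so the rollback that closes the outermost transaction is the first one with its
-- identifier.

theorem Steps.trans {S O : Type} {R : S → List O → S → Prop} {s s' s'' : S} {τ τ' : List O}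
    (h : Steps R s τ s') (h' : Steps R s' τ' s'') : Steps R s (τ ++ τ') s'' := by
  induction h with
  | refl => exact h'
  | head hR _ ih => rw [List.append_assoc]; exact .head hR (ih h')

theorem Steps.single {S O : Type} {R : S → List O → S → Prop} {s s' : S} {τ : List O}
    (h : R s τ s') : Steps R s τ s' := by
  simpa using Steps.head h (.refl s')

/-- Every step has at most one outcome. -/
def Deterministic {S O : Type} (R : S → List O → S → Prop) : Prop :=
  ∀ ⦃s τ₁ s₁ τ₂ s₂⦄, R s τ₁ s₁ → R s τ₂ s₂ → τ₁ = τ₂ ∧ s₁ = s₂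

/-- Determinism lets a known step be stripped from the front of any run that ends in a state without
successors. This is how two complete runs are compared step by step. -/
theorem Steps.tail {S O : Type} {R : S → List O → S → Prop} (hR : Deterministic R)
    {s s' f : S} {τ τ' : List O} (h : Steps R s τ f) (hf : ∀ τ s', ¬ R f τ s') (h' : R s τ' s') :
    ∃ r, τ = τ' ++ r ∧ Steps R s' r f := by
  cases h with
  | refl => exact absurd h' (hf _ _)
  | head h₁ h₂ =>
    obtain ⟨rfl, rfl⟩ := hR h₁ h'
    exact ⟨_, rfl, h₂⟩

theorem Steps.unique {S O : Type} {R : S → List O → S → Prop} (hR : Deterministic R)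
    {s f f' : S} {τ τ' : List O} (h : Steps R s τ f) (h' : Steps R s τ' f')
    (hf : ∀ τ s', ¬ R f τ s') (hf' : ∀ τ s', ¬ R f' τ s') : τ = τ' ∧ f = f' := by
  induction h generalizing τ' with
  | refl =>
    cases h' with
    | refl => exact ⟨rfl, rfl⟩
    | head h₁ _ => exact absurd h₁ (hf _ _)
  | head h₁ _ ih =>
    obtain ⟨r, rfl, hr⟩ := h'.tail hR hf' h₁
    obtain ⟨rfl, rfl⟩ := ih hr hf
    exact ⟨rfl, rfl⟩

/-! ## The non-speculative semantics as a function -/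

/-- The outcome of a non-speculative step, `none` if the configuration is stuck. -/
def nsNext (p : Program) (σ : Config) : Option (Trace × Config) :=
  match σ.regs .pc with
  | none => none
  | some k =>
    match p.at (some k) with
    | none => some ([], ⟨σ.mem, setPc σ.regs none⟩)
    | some .skip => some ([], ⟨σ.mem, setPc σ.regs (some (k + 1))⟩)
    | some .spbarr => some ([], ⟨σ.mem, setPc σ.regs (some (k + 1))⟩)
    | some (.assign x e) =>
      if x = .pc then none
      else some ([], ⟨σ.mem, Function.update (setPc σ.regs (some (k + 1))) x (e.eval σ.regs)⟩)
    | some (.condAssign x e c) =>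
      if x = .pc then none
      else if c.eval σ.regs = some 0 then
        some ([], ⟨σ.mem, Function.update (setPc σ.regs (some (k + 1))) x (e.eval σ.regs)⟩)
      else some ([], ⟨σ.mem, setPc σ.regs (some (k + 1))⟩)
    | some (.load x e) =>
      if x = .pc then none
      else (e.eval σ.regs).map fun n => ([.load (some n)],
        ⟨σ.mem, Function.update (setPc σ.regs (some (k + 1))) x (σ.mem n)⟩)
    | some (.store x e) =>
      (e.eval σ.regs).map fun n => ([.store (some n)],
        ⟨Function.update σ.mem n (σ.regs x), setPc σ.regs (some (k + 1))⟩)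
    | some (.jmp e) => some ([.pc (e.eval σ.regs)], ⟨σ.mem, setPc σ.regs (e.eval σ.regs)⟩)
    | some (.beqz x l) =>
      if σ.regs x = some 0 then some ([.pc l], ⟨σ.mem, setPc σ.regs l⟩)
      else some ([.pc (some (k + 1))], ⟨σ.mem, setPc σ.regs (some (k + 1))⟩)
    | some (.call f) =>
      (p.fn f).bind fun l => (subEight (σ.regs .sp)).map fun n => ([.call f],
        ⟨Function.update σ.mem n (some (k + 1)),
          Function.update (setPc σ.regs (some l)) .sp (some n)⟩)
    | some .ret =>
      (σ.regs .sp).map fun n => ([.ret (σ.mem n)],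
        ⟨σ.mem, Function.update (setPc σ.regs (σ.mem n)) .sp (addEight (σ.regs .sp))⟩)

theorem NSStep.next {p : Program} {σ σ' : Config} {τ : Trace} (h : NSStep p σ τ σ') :
    nsNext p σ = some (τ, σ') := by
  cases h <;> simp [nsNext, *]

/-- As the graph of a partial function the relation is deterministic, and being stuck becomes the
equation `nsNext p σ = none`. -/
theorem nsStep_iff {p : Program} {σ σ' : Config} {τ : Trace} :
    NSStep p σ τ σ' ↔ nsNext p σ = some (τ, σ') := by
  refine ⟨NSStep.next, fun h => ?_⟩
  obtain ⟨m, a⟩ := σ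
  unfold nsNext at h
  split at h
  · cases h
  · rename_i k hk
    simp only at hk
    split at h <;> rename_i hi
    · cases h; exact .terminate hk hi
    · cases h; exact .skip hk hi
    · cases h; exact .spbarr hk hi
    · split_ifs at h with h₁
      cases h; exact .assign hk hi h₁
    · split_ifs at h with h₁ h₂
      · cases h; exact .condAssignSat hk hi h₁ h₂
      · cases h; exact .condAssignUnsat hk hi h₁ h₂
    · split_ifs at h with h₁
      obtain ⟨n, hn, h⟩ := Option.map_eq_some_iff.1 h
      cases h; exact .load hk hi h₁ hn
    · obtain ⟨n, hn, h⟩ := Option.map_eq_some_iff.1 h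
      cases h; exact .store hk hi hn
    · cases h; exact .jmp hk hi
    · split_ifs at h with h₁
      · cases h; exact .beqzSat hk hi h₁
      · cases h; exact .beqzUnsat hk hi h₁
    · obtain ⟨l, hl, h⟩ := Option.bind_eq_some_iff.1 h
      obtain ⟨n, hn, h⟩ := Option.map_eq_some_iff.1 h
      cases h; exact .call hk hi hl hn
    · obtain ⟨n, hn, h⟩ := Option.map_eq_some_iff.1 h
      cases h; exact .ret hk hi hn

theorem nsStep_deterministic (p : Program) : Deterministic (NSStep p) := by
  intro s τ₁ s₁ τ₂ s₂ h₁ h₂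
  simpa using h₁.next.symm.trans h₂.next

theorem stuck_iff {p : Program} {σ : Config} : Stuck p σ ↔ nsNext p σ = none := by
  simp [Stuck, nsStep_iff, Option.eq_none_iff_forall_not_mem]

theorem Config.IsFinal.stuck {p : Program} {σ : Config} (h : σ.IsFinal) : Stuck p σ := by
  unfold Config.IsFinal at h
  simp [stuck_iff, nsNext, h]

theorem Config.IsFinal.not_step {p : Program} {σ σ' : Config} {τ : Trace} (h : σ.IsFinal) :
    ¬ NSStep p σ τ σ' := fun h' => h.stuck ⟨_, _, h'⟩

theorem nsGen_unique {p : Program} {σ : Config} {τ τ' : Trace} (h : nsGen p σ τ)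
    (h' : nsGen p σ τ') : τ = τ' := by
  obtain ⟨f, hs, hf⟩ := h
  obtain ⟨f', hs', hf'⟩ := h'
  exact (hs.unique (nsStep_deterministic p) hs' (fun _ _ => hf.not_step)
    fun _ _ => hf'.not_step).1

/-- Steps at the same line which start equal traces emit the same observations and lead to the
same line. -/
theorem NSStep.pair {p : Program} {σ₁ σ₂ σ₁' σ₂' : Config} {τ₁ τ₂ r₁ r₂ : Trace}
    (hpc : σ₁.regs .pc = σ₂.regs .pc) (h₁ : NSStep p σ₁ τ₁ σ₁') (h₂ : NSStep p σ₂ τ₂ σ₂')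
    (h : τ₁ ++ r₁ = τ₂ ++ r₂) : τ₁ = τ₂ ∧ σ₁'.regs .pc = σ₂'.regs .pc := by
  have h₂ := h₂.next
  unfold nsNext at h₂
  -- Both configurations are at the same line, so the case analysis of the first step also fixes the
  -- instruction in the second. Only operands can differ, and those which influence the next line
  -- are part of the observation.
  rw [← hpc] at h₂
  cases h₁ with
  | condAssignSat hk hi hx | condAssignUnsat hk hi hx =>
    simp only [hk, hi, if_neg hx] at h₂
    split_ifs at h₂ <;> cases h₂ <;> simp [setPc, Function.update, hx.symm]
  | assign hk hi hx =>
    simp only [hk, hi, if_neg hx] at h₂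
    cases h₂; simp [setPc, Function.update, hx.symm]
  | load hk hi hx hn =>
    simp only [hk, hi, if_neg hx] at h₂
    obtain ⟨n, hn, h₂⟩ := Option.map_eq_some_iff.1 h₂
    cases h₂; simp_all [setPc, Function.update, hx.symm]
  | store hk hi hn =>
    simp only [hk, hi] at h₂
    obtain ⟨n, hn, h₂⟩ := Option.map_eq_some_iff.1 h₂
    cases h₂; simp_all [setPc, Function.update]
  | call hk hi hl hn =>
    simp only [hk, hi] at h₂
    obtain ⟨l, hl, h₂⟩ := Option.bind_eq_some_iff.1 h₂
    obtain ⟨n, hn, h₂⟩ := Option.map_eq_some_iff.1 h₂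
    cases h₂; simp_all [setPc, Function.update]
  | ret hk hi hn =>
    simp only [hk, hi] at h₂
    obtain ⟨n, hn, h₂⟩ := Option.map_eq_some_iff.1 h₂
    cases h₂; simp_all [setPc, Function.update]
  | beqzSat hk hi hx | beqzUnsat hk hi hx =>
    simp only [hk, hi] at h₂
    split_ifs at h₂ <;> cases h₂ <;> simp_all [setPc, Function.update]
  | skip hk hi | spbarr hk hi | jmp hk hi | terminate hk hi =>
    simp only [hk, hi] at h₂
    cases h₂; simp_all [setPc, Function.update]

/-- Whether a configuration is stuck depends on more than the line only for instructions that
emit an observation. -/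
theorem Stuck.obs_of_step {p : Program} {σ₁ σ₂ σ₂' : Config} {τ : Trace}
    (hpc : σ₁.regs .pc = σ₂.regs .pc) (h₁ : Stuck p σ₁) (h₂ : NSStep p σ₂ τ σ₂') :
    ∃ o t, τ = o :: t ∧ ∀ c, o ≠ .rollback c := by
  rw [stuck_iff] at h₁
  unfold nsNext at h₁
  rw [hpc] at h₁
  cases h₂ with
  | load hk hi hx hn => simp
  | store | call | ret | jmp | beqzSat | beqzUnsat => simp
  | condAssignSat hk hi hx | condAssignUnsat hk hi hx =>
    simp only [hk, hi, if_neg hx] at h₁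
    split_ifs at h₁
  | assign hk hi hx => simp [hk, hi, if_neg hx] at h₁
  | skip hk hi | spbarr hk hi | terminate hk hi => simp [hk, hi] at h₁

theorem NSStep.obs {p : Program} {σ σ' : Config} {τ : Trace} (h : NSStep p σ τ σ') :
    ∀ o ∈ τ, ∀ c, o ≠ .start c ∧ o ≠ .rollback c := by
  cases h <;> simp

theorem Config.skipAt_pc (σ : Config) (k : ℕ) : (σ.skipAt k).regs .pc = some (k + 1) := by
  simp [Config.skipAt, setPc]

/-! ## Projection -/

theorem nspecAux_none_append {τ r : Trace} (h : ∀ o ∈ τ, ∀ c, o ≠ .start c) :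
    nspecAux none (τ ++ r) = τ ++ nspecAux none r := by
  induction τ with
  | nil => rfl
  | cons o t ih =>
    have ih := ih fun o ho => h o (by simp [ho])
    have ho := h o (by simp)
    cases o <;> simp_all [nspecAux]

theorem nspecAux_some_append {τ r : Trace} {c : ℕ} (h : Obs.rollback c ∉ τ) :
    nspecAux (some c) (τ ++ r) = nspecAux (some c) r := by
  induction τ with
  | nil => rfl
  | cons o t ih =>
    simp only [List.mem_cons, not_or] at h
    have ih := ih h.2
    have ho := h.1
    cases o <;> simp_all [nspecAux]
    intro h; simp_all

/-- How a step of a speculative semantics affects the non-speculative configuration `σ` and the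
identifier `m` of the outermost transaction, if there is one. -/
inductive ProjStep (p : Program) : Option ℕ → Config → Trace → Option ℕ → Config → Prop where
  | exec {σ σ' : Config} {τ : Trace} : NSStep p σ τ σ' → ProjStep p none σ τ none σ'
  | start {σ σ' : Config} {τ : Trace} {c k : ℕ} : NSStep p σ τ σ' →
      ProjStep p none σ (τ ++ [.start c, .skip k]) (some c) σ'
  | spec {σ : Config} {τ : Trace} {c : ℕ} : Obs.rollback c ∉ τ →
      ProjStep p (some c) σ τ (some c) σ
  | rollback {σ : Config} {c : ℕ} : ProjStep p (some c) σ [.rollback c] none σ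

/-- The scan `nspecAux` depends only on the identifier of the outermost open transaction, and the
non-speculative run only on the bottom configuration. An invariant `View` that exposes these two
data is therefore enough, and the argument serves both speculative semantics. -/
theorem Steps.project {p : Program} {S : Type} {R : S → Trace → S → Prop}
    {View : S → Option ℕ → Config → Prop}
    (hR : ∀ s τ s' m σ, View s m σ → R s τ s' → ∃ m' σ', View s' m' σ' ∧ ProjStep p m σ τ m' σ')
    {s s' : S} {τ : Trace} (h : Steps R s τ s') {m : Option ℕ} {σ : Config} (hv : View s m σ) :
    ∃ m' σ', View s' m' σ' ∧ Steps (NSStep p) σ (nspecAux m τ) σ' := by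
  induction h generalizing m σ with
  | refl =>
    refine ⟨m, σ, hv, ?_⟩
    cases m <;> exact .refl _
  | head h₁ _ ih =>
    obtain ⟨m₁, σ₁, hv₁, hp⟩ := hR _ _ _ _ _ hv h₁
    obtain ⟨m₂, σ₂, hv₂, hs⟩ := ih hv₁
    refine ⟨m₂, σ₂, hv₂, ?_⟩
    cases hp with
    | exec hn =>
      rw [nspecAux_none_append fun o ho c => (hn.obs o ho c).1]
      exact .head hn hs
    | start hn =>
      rw [List.append_assoc, nspecAux_none_append fun o ho c => (hn.obs o ho c).1]
      exact .head hn hs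
    | spec hc => rwa [nspecAux_some_append hc]
    | rollback => simpa [nspecAux] using hs

/-! ## Indistinguishable speculative executions -/

/-- `Agree ω p n σ₁ σ₂`: both configurations have, with speculation window `n`, a terminating
speculative execution, in which every store is both executed and bypassed, and these executions
have the same control flow and the same observations. -/
inductive Agree (ω : ℕ) (p : Program) : ℕ∞ → Config → Config → Prop where
  | zero {σ₁ σ₂ : Config} : σ₁.regs .pc = σ₂.regs .pc → Agree ω p 0 σ₁ σ₂
  | stuck {n : ℕ∞} {σ₁ σ₂ : Config} : n ≠ ⊤ → σ₁.regs .pc = σ₂.regs .pc → Stuck p σ₁ →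
      Stuck p σ₂ → Agree ω p n σ₁ σ₂
  | final {σ₁ σ₂ : Config} : σ₁.IsFinal → σ₂.IsFinal → Agree ω p ⊤ σ₁ σ₂
  | store {n : ℕ∞} {σ₁ σ₂ σ₁' σ₂' : Config} {τ : Trace} {k : ℕ} {x : Reg} {e : Expr} :
      σ₁.regs .pc = some k → σ₂.regs .pc = some k → p.at (some k) = some (.store x e) →
      NSStep p σ₁ τ σ₁' → NSStep p σ₂ τ σ₂' →
      Agree ω p (min (ω : ℕ∞) n) (σ₁.skipAt k) (σ₂.skipAt k) → Agree ω p n σ₁' σ₂' →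
      Agree ω p (n + 1) σ₁ σ₂
  | noSpec {n : ℕ∞} {σ₁ σ₂ σ₁' σ₂' : Config} {τ : Trace} :
      σ₁.regs .pc = σ₂.regs .pc → (∀ x e, p.at (σ₁.regs .pc) ≠ some (.store x e)) →
      p.at (σ₁.regs .pc) ≠ some .spbarr → NSStep p σ₁ τ σ₁' → NSStep p σ₂ τ σ₂' →
      Agree ω p n σ₁' σ₂' → Agree ω p (n + 1) σ₁ σ₂
  | barrier {σ₁ σ₂ σ₁' σ₂' : Config} {τ : Trace} :
      σ₁.regs .pc = σ₂.regs .pc → p.at (σ₁.regs .pc) = some .spbarr →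
      NSStep p σ₁ τ σ₁' → NSStep p σ₂ τ σ₂' → Agree ω p ⊤ σ₁' σ₂' → Agree ω p ⊤ σ₁ σ₂
  | barrierSpec {n : ℕ∞} {σ₁ σ₂ σ₁' σ₂' : Config} {τ : Trace} : n ≠ ⊤ →
      σ₁.regs .pc = σ₂.regs .pc → p.at (σ₁.regs .pc) = some .spbarr →
      NSStep p σ₁ τ σ₁' → NSStep p σ₂ τ σ₂' → Agree ω p n σ₁ σ₂

variable {ω : ℕ} {p : Program}

theorem enat_sub_one_add_one {n : ℕ∞} (h : n ≠ 0) : n = n - 1 + 1 :=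
  (tsub_add_cancel_of_le (Order.one_le_iff_ne_zero.2 h)).symm

theorem enat_add_one_sub_one (n : ℕ∞) : n + 1 - 1 = n := by
  induction n using ENat.recTopCoe with
  | top => rfl
  | coe n => norm_cast

theorem Agree.pc_eq {n : ℕ∞} {σ₁ σ₂ : Config} (h : Agree ω p n σ₁ σ₂) :
    σ₁.regs .pc = σ₂.regs .pc := by
  cases h with
  | final h₁ h₂ => exact h₁.trans h₂.symm
  | store h₁ h₂ => exact h₁.trans h₂.symm
  | zero h | stuck _ h | noSpec h | barrier h | barrierSpec _ h => exact h

/-- A smaller window prunes the tree of executions. Where the window drops to `0` the branch is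
closed by `zero`; where it drops from `⊤` to a finite value, `final` turns into `stuck` and
`barrier` into `barrierSpec`. -/
theorem Agree.mono {n m : ℕ∞} {σ₁ σ₂ : Config} (h : Agree ω p n σ₁ σ₂) (hm : m ≤ n) :
    Agree ω p m σ₁ σ₂ := by
  induction h generalizing m with
  | zero h => obtain rfl := nonpos_iff_eq_zero.1 hm; exact .zero h
  | stuck hn h h₁ h₂ => exact .stuck (ne_top_of_le_ne_top hn hm) h h₁ h₂
  | final h₁ h₂ =>
    by_cases hm' : m = ⊤
    · subst hm'; exact .final h₁ h₂
    · exact .stuck hm' (h₁.trans h₂.symm) h₁.stuck h₂.stuck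
  | @store n _ _ _ _ _ _ _ _ h₁ h₂ hi hs₁ hs₂ _ _ ihb ihe =>
    by_cases h0 : m = 0
    · subst h0; exact .zero (h₁.trans h₂.symm)
    · have hm' : m - 1 ≤ n := tsub_le_iff_right.2 hm
      rw [enat_sub_one_add_one h0]
      exact .store h₁ h₂ hi hs₁ hs₂ (ihb (min_le_min le_rfl hm')) (ihe hm')
  | @noSpec n _ _ _ _ _ h hi hi' hs₁ hs₂ _ ih =>
    by_cases h0 : m = 0
    · subst h0; exact .zero h
    · have hm' : m - 1 ≤ n := tsub_le_iff_right.2 hm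
      rw [enat_sub_one_add_one h0]
      exact .noSpec h hi hi' hs₁ hs₂ (ih hm')
  | barrier h hi hs₁ hs₂ hA ih =>
    by_cases hm' : m = ⊤
    · subst hm'; exact .barrier h hi hs₁ hs₂ hA
    · exact .barrierSpec hm' h hi hs₁ hs₂
  | barrierSpec hn h hi hs₁ hs₂ => exact .barrierSpec (ne_top_of_le_ne_top hn hm) h hi hs₁ hs₂

/-- The instruction about to be executed is a store, a barrier, or of another kind. -/
theorem NSStep.kind {σ σ' : Config} {τ : Trace} (h : NSStep p σ τ σ') :
    (∃ k x e, σ.regs .pc = some k ∧ p.at (some k) = some (.store x e)) ∨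
    p.at (σ.regs .pc) = some .spbarr ∨
    ((∀ x e, p.at (σ.regs .pc) ≠ some (.store x e)) ∧ p.at (σ.regs .pc) ≠ some .spbarr) := by
  cases h <;> simp_all

/-- A common introduction rule for the three kinds of instruction. The guard in `he` reflects that a
barrier ends a transaction with finite window, so that nothing after it has to agree. -/
theorem Agree.of_step {n : ℕ∞} {σ₁ σ₂ σ₁' σ₂' : Config} {τ : Trace} (hn : n ≠ 0)
    (hpc : σ₁.regs .pc = σ₂.regs .pc) (h₁ : NSStep p σ₁ τ σ₁') (h₂ : NSStep p σ₂ τ σ₂')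
    (hb : ∀ k x e, σ₁.regs .pc = some k → p.at (some k) = some (.store x e) →
      Agree ω p (min (ω : ℕ∞) (n - 1)) (σ₁.skipAt k) (σ₂.skipAt k))
    (he : (p.at (σ₁.regs .pc) = some .spbarr → n = ⊤) → Agree ω p (n - 1) σ₁' σ₂') :
    Agree ω p n σ₁ σ₂ := by
  rcases h₁.kind with ⟨k, x, e, hk, hi⟩ | hi | ⟨hi, hi'⟩
  · rw [enat_sub_one_add_one hn]
    refine .store hk (hpc ▸ hk) hi h₁ h₂ (hb k x e hk hi) (he ?_)
    rw [hk, hi]; simp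
  · by_cases hn' : n = ⊤
    · subst hn'; exact .barrier hpc hi h₁ h₂ (he fun _ => rfl)
    · exact .barrierSpec hn' hpc hi h₁ h₂
  · rw [enat_sub_one_add_one hn]
    exact .noSpec hpc hi hi' h₁ h₂ (he fun h => absurd h hi')

/-- A finite window bounds the depth of the tree, so it is finite from every configuration,
terminating or not. Reflexive agreement serves as a certificate of termination. -/
theorem Agree.refl_of_ne_top (n : ℕ∞) (hn : n ≠ ⊤) (σ : Config) : Agree ω p n σ σ := by
  lift n to ℕ using hn
  induction n using Nat.strong_induction_on generalizing σ with
  | _ n ih =>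
    by_cases h0 : n = 0
    · subst h0; exact .zero rfl
    by_cases hs : Stuck p σ
    · exact .stuck (ENat.natCast_ne_top n) rfl hs hs
    · obtain ⟨τ, σ', h⟩ := not_not.1 hs
      have hlt : n - 1 < n := by omega
      refine .of_step (by simpa using h0) rfl h h (fun k x e _ _ => ?_)
        fun _ => by simpa using ih (n - 1) hlt σ'
      have := ih (n - 1) hlt (σ.skipAt k)
      exact this.mono (by simp)

theorem Agree.refl_of_steps {σ σ' : Config} {τ : Trace} (h : Steps (NSStep p) σ τ σ')
    (hf : σ'.IsFinal) : Agree ω p ⊤ σ σ := by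
  induction h with
  | refl => exact .final hf hf
  | head h _ ih =>
    refine .of_step (by simp) rfl h h (fun k x e _ _ => .refl_of_ne_top _ ?_ _) fun _ => ih hf
    simp

theorem Agree.stuck_right {n : ℕ∞} {σ₁ σ₂ : Config} (h : Agree ω p n σ₁ σ₂) (hn : n ≠ 0)
    (hs : Stuck p σ₁) : Stuck p σ₂ := by
  cases h with
  | zero => exact absurd rfl hn
  | stuck _ _ _ h => exact h
  | final _ h => exact h.stuck
  | store _ _ _ h | noSpec _ _ _ h | barrier _ _ h | barrierSpec _ _ _ h => exact absurd ⟨_, _, h⟩ hs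

/-- The inversion of `Agree.of_step`. Equality of the next lines is a separate conclusion because a
barrier under a finite window leaves no agreement of the successors from which to read it off. -/
theorem Agree.step {n : ℕ∞} {σ₁ σ₂ σ₁' : Config} {τ : Trace} (h : Agree ω p n σ₁ σ₂)
    (hn : n ≠ 0) (hs : NSStep p σ₁ τ σ₁') :
    ∃ σ₂', NSStep p σ₂ τ σ₂' ∧
      (∀ k x e, σ₁.regs .pc = some k → p.at (some k) = some (.store x e) →
        Agree ω p (min (ω : ℕ∞) (n - 1)) (σ₁.skipAt k) (σ₂.skipAt k)) ∧
      ((p.at (σ₁.regs .pc) = some .spbarr → n = ⊤) → Agree ω p (n - 1) σ₁' σ₂') ∧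
      σ₁'.regs .pc = σ₂'.regs .pc := by
  cases h with
  | zero => exact absurd rfl hn
  | stuck _ _ h => exact absurd ⟨_, _, hs⟩ h
  | final h => exact absurd hs h.not_step
  | @store n _ _ a b _ k _ _ h₁ h₂ hi hs₁ hs₂ hb he =>
    obtain ⟨rfl, rfl⟩ := nsStep_deterministic p hs hs₁
    have : n + 1 - 1 = n := enat_add_one_sub_one n
    refine ⟨_, hs₂, fun k' _ _ hk _ => ?_, fun _ => by rwa [this], he.pc_eq⟩
    obtain rfl : k = k' := by simpa [h₁] using hk
    rwa [this]
  | @noSpec n _ _ a b _ h hi hi' hs₁ hs₂ he =>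
    obtain ⟨rfl, rfl⟩ := nsStep_deterministic p hs hs₁
    have : n + 1 - 1 = n := enat_add_one_sub_one n
    exact ⟨_, hs₂, fun k' x e hk hx => absurd (hk ▸ hx) (hi x e), fun _ => by rwa [this], he.pc_eq⟩
  | barrier h hi hs₁ hs₂ he =>
    obtain ⟨rfl, rfl⟩ := nsStep_deterministic p hs hs₁
    exact ⟨_, hs₂, fun k x e hk hx => by rw [hk, hx] at hi; simp at hi, fun _ => he, he.pc_eq⟩
  | barrierSpec hn' h hi hs₁ hs₂ =>
    obtain ⟨rfl, rfl⟩ := nsStep_deterministic p hs hs₁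
    -- The two steps emit the same observations, so empty remainders suffice for `NSStep.pair` to
    -- yield the same next line.
    exact ⟨_, hs₂, fun k x e hk hx => by rw [hk, hx] at hi; simp at hi,
      fun h => absurd (h hi) hn', (NSStep.pair h hs₁ hs₂ (r₁ := []) (r₂ := []) rfl).2⟩

/-! ## The always-mispredict semantics -/

open Classical in
/-- The outcome of an always-mispredict step, if there is one. -/
noncomputable def amNext (ω : ℕ) (p : Program) : List Inst → Option (Trace × List Inst)
  | [] => none
  | ⟨c, σ, n⟩ :: rest =>
    if n = 0 ∨ Stuck p σ then
      match rest with
      | [] => none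
      | ψ :: rest => some ([.rollback ψ.ctr], { ψ with ctr := c } :: rest)
    else
      (nsNext p σ).bind fun r =>
        match p.at (σ.regs .pc), σ.regs .pc with
        | some (.store _ _), some k => some (r.1 ++ [.start c, .skip k],
            ⟨c + 1, σ.skipAt k, min (ω : ℕ∞) (n - 1)⟩ :: ⟨c, r.2, n - 1⟩ :: rest)
        | some .spbarr, _ => some (r.1, ⟨c, r.2, if n = ⊤ then ⊤ else 0⟩ :: rest)
        | _, _ => some (r.1, ⟨c, r.2, n - 1⟩ :: rest)

theorem NSStep.not_stuck {σ σ' : Config} {τ : Trace} (h : NSStep p σ τ σ') : ¬ Stuck p σ :=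
  fun hs => hs ⟨_, _, h⟩

theorem AMStep.next {s s' : List Inst} {τ : Trace} (h : AMStep ω p s τ s') :
    amNext ω p s = some (τ, s') := by
  cases h with
  | store hk hi h => simp [amNext, h.not_stuck, h.next, hk, hi, enat_add_one_sub_one]
  | noSpec hi hi' h =>
    simp only [amNext, h.not_stuck, h.next, enat_add_one_sub_one]
    rw [if_neg (by simp)]
    simp only [Option.bind_some]
    split <;> simp_all
  | barrier hi h => simp [amNext, h.not_stuck, h.next, hi]
  | @barrierSpec _ n _ _ _ _ hi h =>
    have : (n : ℕ∞) + 1 ≠ ⊤ := by simp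
    simp [amNext, h.not_stuck, h.next, hi]
  | rollback h => simp only [amNext, if_pos h]

theorem amStep_deterministic (ω : ℕ) (p : Program) : Deterministic (AMStep ω p) := by
  intro s τ₁ s₁ τ₂ s₂ h₁ h₂
  simpa using h₁.next.symm.trans h₂.next

theorem Config.IsFinal.not_amStep {c : ℕ} {σ : Config} {n : ℕ∞} (h : σ.IsFinal) (τ : Trace)
    (s : List Inst) : ¬ AMStep ω p [⟨c, σ, n⟩] τ s := by
  intro h'
  have := h'.next
  simp [amNext, h.stuck (p := p)] at this

theorem amGen_unique {σ : Config} {τ τ' : Trace} (h : amGen ω p σ τ)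
    (h' : amGen ω p σ τ') : τ = τ' := by
  obtain ⟨_, _, hs, hf⟩ := h
  obtain ⟨_, _, hs', hf'⟩ := h'
  exact (hs.unique (amStep_deterministic ω p) hs' hf.not_amStep hf'.not_amStep).1

/-! ### Termination -/

/-- Both claims are proved in one induction on the tree: an instance with finite window is
eventually popped, whatever lies below it, and the non-speculating instance reaches a final
configuration. At a store, the first claim for the bypass is followed by the appropriate claim for
the executed branch. The counter must be arbitrary, since the finished bypass hands back a new one.
-/
theorem Agree.am_run {n : ℕ∞} {σ σ₂ : Config} (h : Agree ω p n σ σ₂) :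
    (n ≠ ⊤ → ∀ c ψ rest, ∃ τ c', Steps (AMStep ω p) (⟨c, σ, n⟩ :: ψ :: rest) τ
      ({ ψ with ctr := c' } :: rest)) ∧
    (n = ⊤ → ∀ c, ∃ τ c' σ', Steps (AMStep ω p) [⟨c, σ, ⊤⟩] τ [⟨c', σ', ⊤⟩] ∧ σ'.IsFinal) := by
  induction h with
  | zero => exact ⟨fun _ c ψ rest => ⟨_, _, .single (.rollback (.inl rfl))⟩, fun h => by simp at h⟩
  | stuck hn _ hs =>
    exact ⟨fun _ c ψ rest => ⟨_, _, .single (.rollback (.inr hs))⟩, fun h => absurd h hn⟩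
  | final h => exact ⟨fun h => absurd rfl h, fun _ c => ⟨_, _, _, .refl _, h⟩⟩
  | @store n _ _ a _ _ k _ _ h₁ _ hi hs₁ _ _ _ ihb ihe =>
    have hb (c : ℕ) (rest : List Inst) := ihb.1 (by simp) (c + 1) ⟨c, a, n⟩ rest
    refine ⟨fun hn c ψ rest => ?_, fun hn c => ?_⟩
    · obtain ⟨τ, c₁, hτ⟩ := hb c (ψ :: rest)
      obtain ⟨τ', c₂, hτ'⟩ := ihe.1 (by rintro rfl; simp at hn) c₁ ψ rest
      exact ⟨_, _, .head (.store h₁ hi hs₁) (hτ.trans hτ')⟩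
    · obtain rfl : n = ⊤ := by simpa using hn
      obtain ⟨τ, c₁, hτ⟩ := hb c []
      obtain ⟨τ', c₂, σ', hτ', hf⟩ := ihe.2 rfl c₁
      exact ⟨_, _, _, .head (.store (n := ⊤) h₁ hi hs₁) (hτ.trans hτ'), hf⟩
  | @noSpec n _ _ a _ _ _ hi hi' hs₁ _ _ ih =>
    refine ⟨fun hn c ψ rest => ?_, fun hn c => ?_⟩
    · obtain ⟨τ, c₁, hτ⟩ := ih.1 (by rintro rfl; simp at hn) c ψ rest
      exact ⟨_, _, .head (.noSpec hi hi' hs₁) hτ⟩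
    · obtain rfl : n = ⊤ := by simpa using hn
      obtain ⟨τ, c₁, σ', hτ, hf⟩ := ih.2 rfl c
      exact ⟨_, _, _, .head (.noSpec (n := ⊤) hi hi' hs₁) hτ, hf⟩
  | barrier _ hi hs₁ _ _ ih =>
    refine ⟨fun hn => absurd rfl hn, fun _ c => ?_⟩
    obtain ⟨τ, c₁, σ', hτ, hf⟩ := ih.2 rfl c
    exact ⟨_, _, _, .head (.barrier hi hs₁) hτ, hf⟩
  | @barrierSpec n _ _ _ _ _ hn _ hi hs₁ =>
    refine ⟨fun _ c ψ rest => ?_, fun h => absurd h hn⟩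
    by_cases h0 : n = 0
    · subst h0; exact ⟨_, _, .single (.rollback (.inl rfl))⟩
    · obtain ⟨m, rfl⟩ : ∃ m : ℕ, n = m + 1 := by
        lift n to ℕ using hn
        exact ⟨n - 1, by rw [enat_sub_one_add_one h0]; simp⟩
      exact ⟨_, _, .head (.barrierSpec hi hs₁) (.single (.rollback (.inl rfl)))⟩

theorem exists_amGen {σ : Config} {τ : Trace} (h : nsGen p σ τ) : ∃ τ', amGen ω p σ τ' := by
  obtain ⟨σ', hs, hf⟩ := h
  obtain ⟨τ', c, σ'', h⟩ := (Agree.refl_of_steps (ω := ω) hs hf).am_run.2 rfl 0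
  exact ⟨τ', c, σ'', h⟩

/-! ### Projection -/

/-- A stack with non-speculative configuration `σ`, identifier `c` of the outermost transaction
and topmost counter `t`. -/
inductive AMOver (c : ℕ) (σ : Config) : ℕ → List Inst → Prop where
  | base : AMOver c σ c [⟨c, σ, ⊤⟩]
  | push {t t' : ℕ} {σ' : Config} {n : ℕ∞} {l : List Inst} : t < t' → n ≠ ⊤ → AMOver c σ t l →
      AMOver c σ t' (⟨t', σ', n⟩ :: l)

inductive AMView : List Inst → Option ℕ → Config → Prop where
  | base {c : ℕ} {σ : Config} : AMView [⟨c, σ, ⊤⟩] none σ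
  | spec {c t t' : ℕ} {σ σ' : Config} {n : ℕ∞} {l : List Inst} : t < t' → n ≠ ⊤ →
      AMOver c σ t l → AMView (⟨t', σ', n⟩ :: l) (some c) σ

theorem AMOver.le {c t : ℕ} {σ : Config} {l : List Inst} (h : AMOver c σ t l) : c ≤ t := by
  induction h with
  | base => rfl
  | push h _ _ ih => omega

theorem NSStep.rollback_notMem {σ σ' : Config} {τ : Trace} (h : NSStep p σ τ σ') (c : ℕ) :
    Obs.rollback c ∉ τ := fun hc => (h.obs _ hc c).2 rfl

/-- A rollback emits the counter of the instance below. If that is not the bottom instance, its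
counter exceeds the identifier `c` of the outermost transaction, because counters increase strictly
up the stack; hence only the return to the bottom instance emits `rollback c`. -/
theorem AMStep.project {s s' : List Inst} {τ : Trace} {m : Option ℕ} {σ : Config}
    (hv : AMView s m σ) (h : AMStep ω p s τ s') :
    ∃ m' σ', AMView s' m' σ' ∧ ProjStep p m σ τ m' σ' := by
  cases h with
  | @store c k a a' n x e τ rest hk hi hs =>
    generalize hN : n + 1 = N at hv
    cases hv with
    | base =>
      obtain rfl : n = ⊤ := by simpa using hN
      exact ⟨_, _, .spec (Nat.lt_succ_self _) (by simp) .base, .start hs⟩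
    | spec ht hn ho =>
      have hn' : n ≠ ⊤ := by rintro rfl; simp [← hN] at hn
      refine ⟨_, _, .spec (Nat.lt_succ_self _) (by simp) (.push ht hn' ho), .spec ?_⟩
      simp [hs.rollback_notMem]
  | @noSpec c a a' n τ rest hi hi' hs =>
    generalize hN : n + 1 = N at hv
    cases hv with
    | base =>
      obtain rfl : n = ⊤ := by simpa using hN
      exact ⟨_, _, .base, .exec hs⟩
    | spec ht hn ho =>
      have hn' : n ≠ ⊤ := by rintro rfl; simp [← hN] at hn
      exact ⟨_, _, .spec ht hn' ho, .spec (hs.rollback_notMem _)⟩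
  | barrier hi hs =>
    cases hv with
    | base => exact ⟨_, _, .base, .exec hs⟩
    | spec _ hn => exact absurd rfl hn
  | @barrierSpec c n a a' τ rest hi hs =>
    generalize hN : (n : ℕ∞) + 1 = N at hv
    cases hv with
    | base => simp at hN
    | spec ht hn ho => exact ⟨_, _, .spec ht (by simp) ho, .spec (hs.rollback_notMem _)⟩
  | rollback =>
    cases hv with
    | spec ht hn ho =>
      cases ho with
      | base => exact ⟨_, _, .base, .rollback⟩
      | push ht' hn' ho' =>
        refine ⟨_, _, .spec (ht'.trans ht) hn' ho', .spec ?_⟩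
        have := ho'.le
        simp; omega

theorem amGen.project {σ : Config} {τ : Trace} (h : amGen ω p σ τ) :
    nsGen p σ (nspecProject τ) := by
  obtain ⟨c, σ', hs, hf⟩ := h
  obtain ⟨m, σ'', hv, h⟩ := hs.project (fun _ _ _ _ _ hv h => h.project hv) AMView.base
  refine ⟨σ'', h, ?_⟩
  cases hv with
  | base => exact hf
  | spec _ _ ho => cases ho

/-! ### Agreeing executions -/

/-- Stacks with the same counters and windows, and with agreeing configurations. -/
def AMAgree (ω : ℕ) (p : Program) (s₁ s₂ : List Inst) : Prop :=
  List.Forall₂ (fun ψ₁ ψ₂ => ψ₁.ctr = ψ₂.ctr ∧ ψ₁.win = ψ₂.win ∧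
    Agree ω p ψ₁.win ψ₁.conf ψ₂.conf) s₁ s₂

theorem AMStep.agree {s₁ s₂ s₁' : List Inst} {τ : Trace} (hA : AMAgree ω p s₁ s₂)
    (h : AMStep ω p s₁ τ s₁') : ∃ s₂', AMStep ω p s₂ τ s₂' ∧ AMAgree ω p s₁' s₂' := by
  cases hA with
  | nil => cases h
  | @cons ψ₁ ψ₂ rest₁ rest₂ hψ hr =>
  obtain ⟨c, σ₁, n⟩ := ψ₁
  obtain ⟨c₂, σ₂, n₂⟩ := ψ₂
  simp only at hψ
  obtain ⟨rfl, rfl, hA⟩ := hψ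
  have hpc := hA.pc_eq
  cases h with
  | @store _ k _ σ₁' n x e τ _ hk hi hs =>
    obtain ⟨σ₂', hs', hb, he, -⟩ := hA.step (by simp) hs
    rw [enat_add_one_sub_one] at hb he
    have he := he fun h => by rw [hk, hi] at h; simp at h
    exact ⟨_, .store (hpc ▸ hk) hi hs', .cons ⟨rfl, rfl, hb k x e hk hi⟩ (.cons ⟨rfl, rfl, he⟩ hr)⟩
  | @noSpec _ _ σ₁' n τ _ hi hi' hs =>
    obtain ⟨σ₂', hs', -, he, -⟩ := hA.step (by simp) hs
    rw [enat_add_one_sub_one] at he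
    exact ⟨_, .noSpec (hpc ▸ hi) (hpc ▸ hi') hs', .cons ⟨rfl, rfl, he fun h => absurd h hi'⟩ hr⟩
  | barrier hi hs =>
    obtain ⟨σ₂', hs', -, he, -⟩ := hA.step (by simp) hs
    exact ⟨_, .barrier (hpc ▸ hi) hs', .cons ⟨rfl, rfl, he fun _ => rfl⟩ hr⟩
  | barrierSpec hi hs =>
    obtain ⟨σ₂', hs', -, -, he⟩ := hA.step (by simp) hs
    exact ⟨_, .barrierSpec (hpc ▸ hi) hs', .cons ⟨rfl, rfl, .zero he⟩ hr⟩
  | rollback h =>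
    cases hr with
    | @cons _ ψ₂ _ _ hψ hr =>
    obtain ⟨c₂, a₂, n₂⟩ := ψ₂
    simp only at hψ
    obtain ⟨rfl, rfl, hB⟩ := hψ
    refine ⟨_, .rollback ?_, .cons ⟨rfl, rfl, hB⟩ hr⟩
    by_cases h0 : n = 0
    · exact .inl h0
    · exact .inr (hA.stuck_right h0 (h.resolve_left h0))

theorem Steps.simulate {S O : Type} {R : S → List O → S → Prop} {Rel : S → S → Prop}
    (hR : ∀ s₁ s₂ τ s₁', Rel s₁ s₂ → R s₁ τ s₁' → ∃ s₂', R s₂ τ s₂' ∧ Rel s₁' s₂')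
    {s₁ s₂ s₁' : S} {τ : List O} (h : Steps R s₁ τ s₁') (hs : Rel s₁ s₂) :
    ∃ s₂', Steps R s₂ τ s₂' ∧ Rel s₁' s₂' := by
  induction h generalizing s₂ with
  | refl => exact ⟨_, .refl _, hs⟩
  | head h _ ih =>
    obtain ⟨s, h', hs⟩ := hR _ _ _ _ hs h
    obtain ⟨s₂', h'', hs'⟩ := ih hs
    exact ⟨_, .head h' h'', hs'⟩

theorem amGen.agree {σ₁ σ₂ : Config} {τ : Trace} (h : amGen ω p σ₁ τ)
    (hA : Agree ω p ⊤ σ₁ σ₂) : amGen ω p σ₂ τ := by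
  obtain ⟨c, σ', hs, hf⟩ := h
  obtain ⟨s₂', hs', h⟩ := hs.simulate (Rel := AMAgree ω p) (fun _ _ _ _ h h' => h'.agree h)
    (s₂ := [⟨0, σ₂, ⊤⟩])
    (List.Forall₂.cons ⟨rfl, rfl, hA⟩ .nil)
  cases h with
  | @cons _ ψ _ _ hψ hr =>
  cases hr
  obtain ⟨c₂, a₂, n₂⟩ := ψ
  simp only at hψ
  obtain ⟨rfl, rfl, hB⟩ := hψ
  exact ⟨_, _, hs', hB.pc_eq.symm.trans hf⟩

/-- Stacks with the same counters, windows, and lines. -/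
def AMSimilar (s₁ s₂ : List Inst) : Prop :=
  List.Forall₂ (fun ψ₁ ψ₂ => ψ₁.ctr = ψ₂.ctr ∧ ψ₁.win = ψ₂.win ∧
    ψ₁.conf.regs .pc = ψ₂.conf.regs .pc) s₁ s₂

/-- If one of two similar instances with the same remaining trace can go on, so can the other. -/
theorem exists_nsStep_of_run {c : ℕ} {σ₁ σ₂ σ₁' f : Config} {n : ℕ∞} {rest : List Inst}
    {τ τ₁ r : Trace} {cf : ℕ} (hpc : σ₁.regs .pc = σ₂.regs .pc) (hs : NSStep p σ₁ τ₁ σ₁')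
    (h : Steps (AMStep ω p) (⟨c, σ₂, n⟩ :: rest) τ [⟨cf, f, ⊤⟩]) (hf : f.IsFinal)
    (hτ : τ₁ ++ r = τ) : ∃ τ₂ σ₂', NSStep p σ₂ τ₂ σ₂' := by
  by_contra hst
  obtain ⟨o, t, rfl, ho⟩ := Stuck.obs_of_step hpc.symm hst hs
  cases h with
  | refl => exact absurd hs (Config.IsFinal.not_step (hpc.trans hf))
  | head h₁ h₂ =>
    -- With a stuck instance on top, the run can only begin with a rollback, but the trace begins
    -- with the observation `o`, which is not one.
    have := h₁.next
    cases rest <;> simp [amNext, Stuck, hst] at this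
    obtain ⟨rfl, -⟩ := this
    simp at hτ
    exact ho _ hτ.1

theorem NSStep.exists_amStep {c : ℕ} {σ σ' : Config} {n : ℕ∞} {rest : List Inst} {τ : Trace}
    (h : NSStep p σ τ σ') (hn : n ≠ 0) :
    ∃ τ' s, AMStep ω p (⟨c, σ, n⟩ :: rest) (τ ++ τ') s := by
  rcases h.kind with ⟨k, x, e, hk, hi⟩ | hi | ⟨hi, hi'⟩
  · rw [enat_sub_one_add_one hn]
    exact ⟨_, _, .store hk hi h⟩
  · by_cases hn' : n = ⊤
    · subst hn'; exact ⟨[], _, by simpa using .barrier hi h⟩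
    · obtain ⟨m, rfl⟩ : ∃ m : ℕ, n = m + 1 := by
        lift n to ℕ using hn'
        exact ⟨n - 1, by rw [enat_sub_one_add_one hn]; simp⟩
      exact ⟨[], _, by simpa using .barrierSpec hi h⟩
  · rw [enat_sub_one_add_one hn]
    exact ⟨[], _, by simpa using .noSpec hi hi' h⟩

/-- The derivations of `Agree` are assembled backwards from the ends of the two runs. Since the
stack runs depth first, the remaining trace contains the whole remaining execution of every instance
on it, which allows the claim to be made for all instances at once. The view of the first stack is
carried along only to know that a popped instance has a finite window. -/
theorem agree_of_am_runs {s₁ s₂ s₁' s₂' : List Inst} {τ : Trace}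
    (h₁ : Steps (AMStep ω p) s₁ τ s₁') (h₂ : Steps (AMStep ω p) s₂ τ s₂')
    (hs : AMSimilar s₁ s₂) {m : Option ℕ} {σ : Config} (hv : AMView s₁ m σ) (hf₁ : ∃ c σ, s₁' = [⟨c, σ, ⊤⟩] ∧ σ.IsFinal)
    (hf₂ : ∃ c σ, s₂' = [⟨c, σ, ⊤⟩] ∧ σ.IsFinal) : AMAgree ω p s₁ s₂ := by
  induction h₁ generalizing s₂ m σ with
  | refl =>
    obtain ⟨c, σ, rfl, hf⟩ := hf₁
    cases hs with
    | @cons _ ψ _ _ hψ hr =>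
    cases hr
    obtain ⟨c₂, a₂, n₂⟩ := ψ
    simp only at hψ
    obtain ⟨rfl, rfl, hB⟩ := hψ
    exact .cons ⟨rfl, rfl, .final hf (hB.symm.trans hf)⟩ .nil
  | @head s₁ s₁m s₁' τ₁ r₁ h _ ih =>
    obtain ⟨cf, f, rfl, hf⟩ := hf₂
    obtain ⟨m', σ', hv', -⟩ := h.project hv
    have tail := fun {τ' s'} => h₂.tail (τ' := τ') (s' := s') (amStep_deterministic ω p)
      hf.not_amStep
    cases hs with
    | nil => cases h
    | @cons ψ₁ ψ₂ rest₁ rest₂ hψ hr =>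
    obtain ⟨c, σ₁, n⟩ := ψ₁
    obtain ⟨c₂, σ₂, n₂⟩ := ψ₂
    simp only at hψ
    obtain ⟨rfl, rfl, hpc⟩ := hψ
    cases h with
    | @store _ k _ σ₁' n x e τ₁ _ hk hi hs =>
      obtain ⟨τ₂, σ₂', hs'⟩ := exists_nsStep_of_run hpc hs h₂ hf (List.append_assoc _ _ _).symm
      obtain ⟨r, hr', hrun⟩ := tail (.store (hpc ▸ hk) hi hs')
      rw [List.append_assoc, List.append_assoc] at hr'
      obtain ⟨rfl, hpc'⟩ := hs.pair hpc hs' hr'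
      obtain rfl : r₁ = r := by simpa using hr'
      -- The two topmost instances after the step are the bypass and the executed branch; their
      -- agreements are the two premises of `Agree.store`.
      cases ih hrun (.cons ⟨rfl, rfl, by simp [Config.skipAt_pc]⟩ (.cons ⟨rfl, rfl, hpc'⟩ hr))
        hv' hf₁ with
      | cons h₁ h₂ =>
      cases h₂ with
      | cons h₂ h₃ =>
      exact .cons ⟨rfl, rfl, .store hk (hpc ▸ hk) hi hs hs' h₁.2.2 h₂.2.2⟩ h₃
    | @noSpec _ _ σ₁' n τ₁ _ hi hi' hs =>
      obtain ⟨τ₂, σ₂', hs'⟩ := exists_nsStep_of_run hpc hs h₂ hf rfl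
      obtain ⟨r, hr', hrun⟩ := tail (.noSpec (hpc ▸ hi) (hpc ▸ hi') hs')
      obtain ⟨rfl, hpc'⟩ := hs.pair hpc hs' hr'
      obtain rfl : r₁ = r := by simpa using hr'
      cases ih hrun (.cons ⟨rfl, rfl, hpc'⟩ hr) hv' hf₁ with
      | cons h₁ h₂ => exact .cons ⟨rfl, rfl, .noSpec hpc hi hi' hs hs' h₁.2.2⟩ h₂
    | barrier hi hs =>
      obtain ⟨τ₂, σ₂', hs'⟩ := exists_nsStep_of_run hpc hs h₂ hf rfl
      obtain ⟨r, hr', hrun⟩ := tail (.barrier (hpc ▸ hi) hs')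
      obtain ⟨rfl, hpc'⟩ := hs.pair hpc hs' hr'
      obtain rfl : r₁ = r := by simpa using hr'
      cases ih hrun (.cons ⟨rfl, rfl, hpc'⟩ hr) hv' hf₁ with
      | cons h₁ h₂ => exact .cons ⟨rfl, rfl, .barrier hpc hi hs hs' h₁.2.2⟩ h₂
    | barrierSpec hi hs =>
      obtain ⟨τ₂, σ₂', hs'⟩ := exists_nsStep_of_run hpc hs h₂ hf rfl
      obtain ⟨r, hr', hrun⟩ := tail (.barrierSpec (hpc ▸ hi) hs')
      obtain ⟨rfl, hpc'⟩ := hs.pair hpc hs' hr'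
      obtain rfl : r₁ = r := by simpa using hr'
      cases ih hrun (.cons ⟨rfl, rfl, hpc'⟩ hr) hv' hf₁ with
      | cons h₁ h₂ => exact .cons ⟨rfl, rfl, .barrierSpec (by simp) hpc hi hs hs'⟩ h₂
    | rollback h =>
      cases hr with
      | @cons _ ψ₂ _ _ hψ hr =>
      obtain ⟨c₂, a₂, n₂⟩ := ψ₂
      simp only at hψ
      obtain ⟨rfl, rfl, hB⟩ := hψ
      -- If the window is not used up, the second instance has to be stuck as well: a step from it
      -- would put an observation other than a rollback where the common trace has a rollback.
      have hst : n = 0 ∨ n ≠ 0 ∧ Stuck p σ₁ ∧ Stuck p σ₂ := by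
        by_cases h0 : n = 0
        · exact .inl h0
        have hσ := h.resolve_left h0
        refine .inr ⟨h0, hσ, ?_⟩
        rintro ⟨τ₂, σ₂', hs'⟩
        obtain ⟨τ', s, hs''⟩ := hs'.exists_amStep (ω := ω) (c := c) (rest := ⟨_, a₂, _⟩ :: _) h0
        obtain ⟨r, hr', -⟩ := tail hs''
        obtain ⟨o, t, rfl, ho⟩ := hσ.obs_of_step hpc hs'
        simp only [List.cons_append, List.cons.injEq] at hr'
        exact ho _ hr'.1.symm
      obtain ⟨r, hr', hrun⟩ := tail (.rollback (hst.imp_right fun h => h.2.2))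
      obtain rfl : r₁ = r := by simpa using hr'
      have hn : n ≠ ⊤ := by cases hv with | spec _ hn => exact hn
      cases ih hrun (.cons ⟨rfl, rfl, hB⟩ hr) hv' hf₁ with
      | cons h₁ h₂ =>
      refine .cons ⟨rfl, rfl, ?_⟩ (.cons ⟨rfl, rfl, h₁.2.2⟩ h₂)
      rcases hst with rfl | hst
      · exact .zero hpc
      · exact .stuck hn hpc hst.2.1 hst.2.2

theorem agree_of_amGen {σ₁ σ₂ : Config} {τ : Trace} (hpc : σ₁.regs .pc = σ₂.regs .pc)
    (h₁ : amGen ω p σ₁ τ) (h₂ : amGen ω p σ₂ τ) : Agree ω p ⊤ σ₁ σ₂ := by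
  obtain ⟨c₁, f₁, hs₁, hf₁⟩ := h₁
  obtain ⟨c₂, f₂, hs₂, hf₂⟩ := h₂
  cases agree_of_am_runs hs₁ hs₂ (.cons ⟨rfl, rfl, hpc⟩ .nil) .base ⟨_, _, rfl, hf₁⟩
    ⟨_, _, rfl, hf₂⟩ with
  | cons h => exact h.2.2

variable {O : Oracle ω}

/-! ## The oracle semantics -/

open Classical in
/-- The outcome of an oracle step, if there is one. -/
noncomputable def oNext (ω : ℕ) (O : Oracle ω) (p : Program) :
    List OInst → Option (Trace × List OInst)
  | [] => none
  | ⟨c, σ, h, n⟩ :: rest =>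
    if Enabled (⟨c, σ, h, n⟩ :: rest) then
      if Stuck p σ then
        match rest with
        | [] => none
        | ψ :: rest => some ([.rollback ψ.ctr], { ψ with ctr := c } :: rest)
      else
        (nsNext p σ).bind fun r =>
          match p.at (σ.regs .pc), σ.regs .pc with
          | some (.store _ _), some k =>
            match O p h k with
            | some w => some (r.1 ++ [.start c, .skip k],
                ⟨c + 1, σ.skipAt k, h ++ [(k, true)], ((w : ℕ) : ℕ∞)⟩ ::
                  ⟨c, r.2, h ++ [(k, false)], n - 1⟩ :: rest.map OInst.decr)
            | none => some (r.1, ⟨c, r.2, h ++ [(k, false)], n - 1⟩ :: rest.map OInst.decr)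
          | some .spbarr, _ => some (r.1, OInst.zero ⟨c, r.2, h, n⟩ :: rest.map OInst.zero)
          | _, _ => some (r.1, ⟨c, r.2, h, n - 1⟩ :: rest.map OInst.decr)
    else
      match (⟨c, σ, h, n⟩ :: rest : List OInst).dropWhile fun ψ => decide (ψ.win ≠ 0) with
      | _ :: ψ :: rest => some ([.rollback ψ.ctr], { ψ with ctr := c } :: rest)
      | _ => none

/-- Identifies the topmost exhausted instance, so that the split of the stack in the rule `rollback`
is unique. -/
theorem Enabled.dropWhile {above l : List OInst} {ψ : OInst} (h : Enabled above)
    (hψ : ψ.win = 0) :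
    (above ++ ψ :: l).dropWhile (fun ψ => decide (ψ.win ≠ 0)) = ψ :: l := by
  rw [List.dropWhile_append_of_pos (by simpa [Enabled] using h)]
  simp [hψ]

theorem OStep.next {s s' : List OInst} {τ : Trace} (h : OStep ω O p s τ s') :
    oNext ω O p s = some (τ, s') := by
  cases h with
  | storeSkip he hk hi h ho => simp [oNext, he, h.not_stuck, h.next, hk, hi, ho]
  | storeExec he hk hi h ho => simp [oNext, he, h.not_stuck, h.next, hk, hi, ho]
  | noSpec he hi hi' h =>
    simp only [oNext, he, h.not_stuck, h.next, if_true, if_false]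
    simp only [Option.bind_some]
    split <;> simp_all
  | barrier he hi h => simp [oNext, he, h.not_stuck, h.next, hi]
  | @rollback above rest ψ' ψ top ha hψ ht =>
    have hd := ha.dropWhile (l := ψ :: rest) hψ
    have hne : ¬ Enabled (above ++ ψ' :: ψ :: rest) := fun h => h ψ' (by simp) hψ
    cases above with
    | nil =>
      obtain rfl : ψ' = top := by simpa using ht
      simp only [List.nil_append] at hd hne ⊢
      simp only [oNext, if_neg hne, hd]
    | cons a above =>
      obtain rfl : a = top := by simpa using ht
      simp only [List.cons_append] at hd hne ⊢
      simp only [oNext, if_neg hne, hd]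
  | rollbackStuck he h => simp only [oNext, if_pos h, if_pos he]

theorem oStep_deterministic (ω : ℕ) (O : Oracle ω) (p : Program) :
    Deterministic (OStep ω O p) := by
  intro s τ₁ s₁ τ₂ s₂ h₁ h₂
  simpa using h₁.next.symm.trans h₂.next

/-- The stacks in which a terminating execution ends. -/
def OFinal (s : List OInst) : Prop := ∃ c σ h, s = [⟨c, σ, h, ⊤⟩] ∧ σ.IsFinal

theorem OFinal.not_step {s : List OInst} (h : OFinal s) (τ : Trace) (s' : List OInst) :
    ¬ OStep ω O p s τ s' := by
  obtain ⟨c, σ, h, rfl, hf⟩ := h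
  intro h'
  have := h'.next
  simp [oNext, hf.stuck (p := p), Enabled] at this

theorem oracleGen_iff {σ : Config} {τ : Trace} :
    oracleGen ω O p σ τ ↔ ∃ s, Steps (OStep ω O p) [⟨0, σ, [], ⊤⟩] τ s ∧ OFinal s := by
  constructor
  · rintro ⟨c, σ', h, hs, hf⟩
    exact ⟨_, hs, c, σ', h, rfl, hf⟩
  · rintro ⟨_, hs, c, σ', h, rfl, hf⟩
    exact ⟨c, σ', h, hs, hf⟩

theorem oracleGen_unique {σ : Config} {τ τ' : Trace} (h : oracleGen ω O p σ τ)
    (h' : oracleGen ω O p σ τ') : τ = τ' := by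
  obtain ⟨_, hs, hf⟩ := oracleGen_iff.1 h
  obtain ⟨_, hs', hf'⟩ := oracleGen_iff.1 h'
  exact (hs.unique (oStep_deterministic ω O p) hs' hf.not_step hf'.not_step).1

/-! ### Projection -/

/-- A stack with non-speculative configuration `σ`, identifier `c` of the outermost transaction
and topmost counter `t`. -/
inductive OOver (c : ℕ) (σ : Config) : ℕ → List OInst → Prop where
  | base {h : History} : OOver c σ c [⟨c, σ, h, ⊤⟩]
  | push {t t' : ℕ} {σ' : Config} {h : History} {n : ℕ∞} {l : List OInst} : t < t' →
      OOver c σ t l → OOver c σ t' (⟨t', σ', h, n⟩ :: l)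

inductive OView : List OInst → Option ℕ → Config → Prop where
  | base {c : ℕ} {σ : Config} {h : History} : OView [⟨c, σ, h, ⊤⟩] none σ
  | spec {c t t' : ℕ} {σ σ' : Config} {h : History} {n : ℕ∞} {l : List OInst} : t < t' →
      OOver c σ t l → OView (⟨t', σ', h, n⟩ :: l) (some c) σ

theorem OOver.le {c t : ℕ} {σ : Config} {l : List OInst} (h : OOver c σ t l) : c ≤ t := by
  induction h with
  | base => rfl
  | push h _ ih => omega

theorem OOver.decr {c t : ℕ} {σ : Config} {l : List OInst} (h : OOver c σ t l) :
    OOver c σ t (l.map OInst.decr) := by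
  induction h with
  | base => exact .base
  | push h _ ih => exact .push h ih

theorem OOver.zero {c t : ℕ} {σ : Config} {l : List OInst} (h : OOver c σ t l) :
    OOver c σ t (l.map OInst.zero) := by
  induction h with
  | base => exact .base
  | push h _ ih => exact .push h ih

theorem OOver.suffix {c t : ℕ} {σ : Config} {above l : List OInst} {ψ : OInst}
    (h : OOver c σ t (above ++ ψ :: l)) : OOver c σ ψ.ctr (ψ :: l) ∧ ψ.ctr ≤ t := by
  induction above generalizing t with
  | nil => cases h with
    | base => exact ⟨.base, le_rfl⟩
    | push ht ho => exact ⟨.push ht ho, le_rfl⟩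
  | cons a above ih =>
    rw [List.cons_append] at h
    generalize hl : above ++ ψ :: l = l' at h
    cases h with
    | base => simp at hl
    | push ht ho =>
      subst hl
      exact ⟨(ih ho).1, (ih ho).2.trans ht.le⟩

theorem OOver.view_of_rollback {c t : ℕ} {σ : Config} {l : List OInst} {ψ : OInst}
    (h : OOver c σ ψ.ctr (ψ :: l)) (ht : ψ.ctr < t) :
    ∃ m' σ', OView ({ ψ with ctr := t } :: l) m' σ' ∧
      ProjStep p (some c) σ [.rollback ψ.ctr] m' σ' := by
  obtain ⟨cψ, σψ, hψ, n⟩ := ψ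
  simp only at h ht
  cases h with
  | base => exact ⟨_, _, .base, .rollback⟩
  | push h ho =>
    have := ho.le
    exact ⟨_, _, .spec (h.trans ht) ho, .spec (by simp; omega)⟩

/-- As for the always-mispredict semantics, except that a rollback may delete several instances.
Counters still increase up the stack, so the counter taken over from the top exceeds all those that
remain below. -/
theorem OStep.project {s s' : List OInst} {τ : Trace} {m : Option ℕ} {σ : Config}
    (hv : OView s m σ) (h : OStep ω O p s τ s') :
    ∃ m' σ', OView s' m' σ' ∧ ProjStep p m σ τ m' σ' := by
  cases h with
  | storeSkip _ hk hi hs =>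
    cases hv with
    | base => exact ⟨_, _, .spec (Nat.lt_succ_self _) .base, .start hs⟩
    | spec ht ho =>
      refine ⟨_, _, .spec (Nat.lt_succ_self _) (.push ht ho.decr), .spec ?_⟩
      simp [hs.rollback_notMem]
  | storeExec _ hk hi hs =>
    cases hv with
    | base => exact ⟨_, _, .base, .exec hs⟩
    | spec ht ho => exact ⟨_, _, .spec ht ho.decr, .spec (hs.rollback_notMem _)⟩
  | noSpec _ hk hi hs =>
    cases hv with
    | base => exact ⟨_, _, .base, .exec hs⟩
    | spec ht ho => exact ⟨_, _, .spec ht ho.decr, .spec (hs.rollback_notMem _)⟩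
  | barrier _ hi hs =>
    cases hv with
    | base => exact ⟨_, _, .base, .exec hs⟩
    | spec ht ho => exact ⟨_, _, .spec ht ho.zero, .spec (hs.rollback_notMem _)⟩
  | @rollback above rest ψ' ψ top _ _ htop =>
    cases above with
    | nil =>
      obtain rfl : ψ' = top := by simpa using htop
      cases hv with
      | spec ht ho =>
        obtain ⟨ho, hle⟩ := ho.suffix (above := [])
        exact ho.view_of_rollback (hle.trans_lt ht)
    | cons a above =>
      obtain rfl : a = top := by simpa using htop
      generalize hl : above ++ ψ' :: ψ :: rest = l at *
      rw [List.cons_append, hl] at hv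
      cases hv with
      | base => simp at hl
      | spec ht ho =>
        rw [← hl, List.append_cons] at ho
        obtain ⟨ho, hle⟩ := ho.suffix
        exact ho.view_of_rollback (hle.trans_lt ht)
  | rollbackStuck =>
    cases hv with
    | spec ht ho =>
      obtain ⟨ho, hle⟩ := ho.suffix (above := [])
      exact ho.view_of_rollback (hle.trans_lt ht)

theorem oracleGen.project {σ : Config} {τ : Trace} (h : oracleGen ω O p σ τ) :
    nsGen p σ (nspecProject τ) := by
  obtain ⟨c, σ', h, hs, hf⟩ := h
  obtain ⟨m, σ'', hv, h⟩ := hs.project (fun _ _ _ _ _ hv h => h.project hv) OView.base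
  refine ⟨σ'', h, ?_⟩
  cases hv with
  | base => exact hf
  | spec _ ho => cases ho

/-! ### Termination -/

/-- A uniform shape for all oracle steps that execute an instruction: `f` is the effect on the
windows of the existing instances, and `above` is empty or holds the instance of a new bypass. -/
theorem NSStep.exists_oStep {c : ℕ} {σ σ' : Config} {h : History} {n : ℕ∞} {rest : List OInst}
    {τ : Trace} (hs : NSStep p σ τ σ') (he : Enabled (⟨c, σ, h, n⟩ :: rest)) :
    ∃ τ' above h' f, (f = OInst.decr ∨ f = OInst.zero) ∧ (∀ ψ ∈ above, ψ.win ≠ ⊤) ∧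
      OStep ω O p (⟨c, σ, h, n⟩ :: rest) (τ ++ τ')
        (above ++ f ⟨c, σ', h', n⟩ :: rest.map f) := by
  rcases hs.kind with ⟨k, x, e, hk, hi⟩ | hi | ⟨hi, hi'⟩
  · rcases ho : O p h k with _ | w
    · exact ⟨[], [], _, _, .inl rfl, by simp, by simpa using .storeExec he hk hi hs ho⟩
    · exact ⟨_, [_], _, _, .inl rfl, by simp, .storeSkip he hk hi hs ho⟩
  · exact ⟨[], [], _, _, .inr rfl, by simp, by simpa using .barrier he hi hs⟩
  · exact ⟨[], [], _, _, .inl rfl, by simp, by simpa using .noSpec he hi hi' hs⟩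

theorem exists_split_of_not_enabled {Ψ : List OInst} (h : ¬ Enabled Ψ) :
    ∃ above ψ below, Ψ = above ++ ψ :: below ∧ Enabled above ∧ ψ.win = 0 := by
  induction Ψ with
  | nil => exact absurd (by simp [Enabled]) h
  | cons a Ψ ih =>
    by_cases ha : a.win = 0
    · exact ⟨[], a, Ψ, rfl, by simp [Enabled], ha⟩
    · obtain ⟨above, ψ, below, rfl, he, hψ⟩ := ih fun h' => h (by simpa [Enabled, ha] using h')
      exact ⟨a :: above, ψ, below, rfl, by simpa [Enabled, ha] using he, hψ⟩

/-- Every transaction ends. -/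
theorem exists_oracle_rollback (N L : ℕ) (Ψ : List OInst) (ψ₀ : OInst) (hL : Ψ.length = L)
    (hN : (Ψ.map OInst.win).getLast? = some (N : ℕ∞)) (h₀ : ψ₀.win = ⊤) :
    ∃ τ c, Steps (OStep ω O p) (Ψ ++ [ψ₀]) τ [{ ψ₀ with ctr := c }] := by
  -- Lexicographic induction on the window `N` of the lowest speculating instance and the height of
  -- the stack. Executing an instruction lowers `N`, even if the stack grows; a rollback either
  -- deletes the lowest speculating instance, which ends the transaction, or keeps `N` and shortens
  -- the stack.
  induction N using Nat.strong_induction_on generalizing L Ψ ψ₀ with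
  | _ N ihN =>
  induction L using Nat.strong_induction_on generalizing Ψ ψ₀ with
  | _ L ihL =>
  subst hL
  by_cases he : Enabled Ψ
  · obtain _ | ⟨⟨c, σ, h, n⟩, rest⟩ := Ψ
    · simp at hN
    have he' : Enabled (⟨c, σ, h, n⟩ :: (rest ++ [ψ₀])) := by
      intro ψ hψ
      simp only [List.mem_cons, List.mem_append, List.not_mem_nil, or_false] at hψ
      rcases hψ with rfl | hψ | rfl
      · exact he _ (by simp)
      · exact he _ (by simp [hψ])
      · simp [h₀]
    by_cases hs : Stuck p σ
    · obtain _ | ⟨ψ, rest⟩ := rest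
      · exact ⟨_, _, .single (.rollbackStuck he' hs)⟩
      · obtain ⟨τ, c', hτ⟩ := ihL _ (by simp) ({ ψ with ctr := c } :: rest) ψ₀ rfl
          (by simpa using hN) h₀
        exact ⟨_, _, .head (.rollbackStuck he' hs) hτ⟩
    · obtain ⟨τ, σ', hs⟩ := not_not.1 hs
      obtain ⟨τ', above, h', f, hf, ha, hstep⟩ := hs.exists_oStep (ω := ω) (O := O) he'
      have hN0 : N ≠ 0 := by
        rintro rfl
        obtain ⟨ψ, hψ, hw⟩ := List.mem_map.1 (List.mem_of_getLast? hN)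
        exact he ψ hψ (by simpa using hw)
      -- Both possible effects act on windows through a function `g` that fixes `⊤` and lowers the
      -- nonzero `N`: to `N - 1` for an ordinary instruction, to `0` for a barrier.
      have hg : ∃ g : ℕ∞ → ℕ∞, (∀ ψ, (f ψ).win = g ψ.win) ∧ f ψ₀ = ψ₀ ∧
          ∃ M : ℕ, M < N ∧ g N = M := by
        obtain ⟨c₀, σ₀, h₀', n₀⟩ := ψ₀
        simp only at h₀
        subst h₀
        rcases hf with rfl | rfl
        · refine ⟨fun w => w - 1, fun _ => rfl, rfl, N - 1, by omega, by simp⟩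
        · exact ⟨fun w => if w = ⊤ then ⊤ else 0, fun _ => rfl, rfl, 0, by omega, by simp⟩
      obtain ⟨g, hg, hf₀, M, hM, hgM⟩ := hg
      obtain ⟨τ'', c', hτ⟩ := ihN M hM _ (above ++ f ⟨c, σ', h', n⟩ :: rest.map f) ψ₀ rfl (by
        have : (f ⟨c, σ', h', n⟩ :: rest.map f).map OInst.win
            = ((⟨c, σ, h, n⟩ :: rest : List OInst).map OInst.win).map g := by
          simp [hg]
        rw [List.map_append, List.getLast?_append, this, List.getLast?_map, hN]
        simp [hgM]) h₀
      exact ⟨_, c', .head hstep (τ' := τ'') (by simpa [hf₀] using hτ)⟩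
  · obtain ⟨above, ψ, below, rfl, ha, hψ⟩ := exists_split_of_not_enabled he
    obtain ⟨top, ht⟩ : ∃ top, (above ++ [ψ]).head? = some top := by
      cases above <;> simp
    obtain _ | ⟨ψ', below⟩ := below
    · exact ⟨_, _, .single (by simpa using .rollback (rest := []) ha hψ ht)⟩
    · obtain ⟨τ, c', hτ⟩ := ihL _ (by simp; omega) ({ ψ' with ctr := top.ctr } :: below) ψ₀ rfl
        (by simpa [List.getLast?_append] using hN) h₀
      have hstep := OStep.rollback (O := O) (p := p) (ψ := ψ') (rest := below ++ [ψ₀]) ha hψ ht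
      exact ⟨_, c', .head (by simpa using hstep) hτ⟩

/-- Each non-speculative step is matched by an oracle step of the bottom instance; if that step
opens a transaction, the transaction ends by `exists_oracle_rollback` and leaves the bottom
configuration unchanged. -/
theorem exists_oracle_run {σ σ' : Config} {τ : Trace} (hs : Steps (NSStep p) σ τ σ')
    (hf : σ'.IsFinal) (c : ℕ) (h : History) :
    ∃ τ s, Steps (OStep ω O p) [⟨c, σ, h, ⊤⟩] τ s ∧ OFinal s := by
  induction hs generalizing c h with
  | refl => exact ⟨_, _, .refl _, _, _, _, rfl, hf⟩
  | @head σ σ₁ σ' τ τ' hs _ ih =>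
    obtain ⟨τ', above, h', f, hf', ha, hstep⟩ := hs.exists_oStep (ω := ω) (O := O) (c := c)
      (h := h) (n := ⊤) (rest := []) (by simp [Enabled])
    have hf₀ : f ⟨c, σ₁, h', ⊤⟩ = ⟨c, σ₁, h', ⊤⟩ := by rcases hf' with rfl | rfl <;> rfl
    rw [hf₀] at hstep
    have : ∃ τ c', Steps (OStep ω O p) (above ++ [⟨c, σ₁, h', ⊤⟩]) τ [⟨c', σ₁, h', ⊤⟩] := by
      rcases hl : (above.map OInst.win).getLast? with _ | w
      · obtain rfl : above = [] := by simpa using hl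
        exact ⟨_, _, .refl _⟩
      · obtain ⟨ψ, hψ, rfl⟩ := List.mem_map.1 (List.mem_of_getLast? hl)
        obtain ⟨N, hN⟩ := ENat.ne_top_iff_exists.1 (ha ψ hψ)
        exact exists_oracle_rollback N _ above _ rfl (by rw [hl, hN]) rfl
    obtain ⟨τ₁, c₁, h₁⟩ := this
    obtain ⟨τ₂, s, h₂, hs⟩ := ih hf c₁ h'
    exact ⟨_, _, .head hstep (h₁.trans h₂), hs⟩

theorem exists_oracleGen {σ : Config} {τ : Trace} (h : nsGen p σ τ) (O : Oracle ω) :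
    ∃ τ', oracleGen ω O p σ τ' := by
  obtain ⟨σ', hs, hf⟩ := h
  obtain ⟨τ', s, h⟩ := exists_oracle_run (ω := ω) (O := O) hs hf 0 []
  exact ⟨τ', oracleGen_iff.2 ⟨s, h⟩⟩

/-! ### Agreeing executions -/

/-- The number of steps until some instance on the stack is rolled back. -/
noncomputable def minWin : List OInst → ℕ∞
  | [] => ⊤
  | ψ :: Ψ => min ψ.win (minWin Ψ)

theorem minWin_ne_zero_iff {Ψ : List OInst} : minWin Ψ ≠ 0 ↔ Enabled Ψ := by
  induction Ψ with
  | nil => simp [minWin, Enabled]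
  | cons ψ Ψ ih =>
    have : Enabled (ψ :: Ψ) ↔ ψ.win ≠ 0 ∧ Enabled Ψ := by simp [Enabled]
    rw [this, ← ih, minWin]
    simp only [← pos_iff_ne_zero, lt_min_iff]

theorem enat_min_sub_one (a b : ℕ∞) : min a b - 1 = min (a - 1) (b - 1) :=
  Monotone.map_min (f := fun x : ℕ∞ => x - 1) fun _ _ h => tsub_le_tsub_right h 1

theorem minWin_decr (Ψ : List OInst) : minWin (Ψ.map OInst.decr) = minWin Ψ - 1 := by
  induction Ψ with
  | nil => rfl
  | cons ψ Ψ ih => simp only [List.map_cons, minWin, ih, enat_min_sub_one, OInst.decr]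

theorem minWin_zero (Ψ : List OInst) :
    minWin (Ψ.map OInst.zero) = if minWin Ψ = ⊤ then ⊤ else 0 := by
  induction Ψ with
  | nil => rfl
  | cons ψ Ψ ih =>
    simp only [List.map_cons, minWin, ih, OInst.zero]
    by_cases h : ψ.win = ⊤ <;> by_cases h' : minWin Ψ = ⊤ <;> simp [h, h']

/-- Stacks with the same counters, histories and windows, and with configurations that agree until
the next rollback. -/
inductive OAgree (ω : ℕ) (p : Program) : List OInst → List OInst → Prop where
  | nil : OAgree ω p [] []
  | cons {c : ℕ} {h : History} {n : ℕ∞} {σ₁ σ₂ : Config} {r₁ r₂ : List OInst} :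
      Agree ω p (min n (minWin r₁)) σ₁ σ₂ → OAgree ω p r₁ r₂ →
      OAgree ω p (⟨c, σ₁, h, n⟩ :: r₁) (⟨c, σ₂, h, n⟩ :: r₂)

theorem OAgree.enabled {Ψ₁ Ψ₂ : List OInst} (h : OAgree ω p Ψ₁ Ψ₂) (he : Enabled Ψ₁) :
    Enabled Ψ₂ := by
  induction h with
  | nil => exact he
  | cons _ _ ih =>
    simp only [Enabled, List.mem_cons, forall_eq_or_imp] at he ih ⊢
    exact ⟨he.1, ih he.2⟩

theorem OAgree.decr {Ψ₁ Ψ₂ : List OInst} (h : OAgree ω p Ψ₁ Ψ₂) :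
    OAgree ω p (Ψ₁.map OInst.decr) (Ψ₂.map OInst.decr) := by
  induction h with
  | nil => exact .nil
  | cons hA _ ih =>
    refine .cons (hA.mono ?_) ih
    rw [minWin_decr]
    exact min_le_min tsub_le_self tsub_le_self

theorem OAgree.zero {Ψ₁ Ψ₂ : List OInst} (h : OAgree ω p Ψ₁ Ψ₂) :
    OAgree ω p (Ψ₁.map OInst.zero) (Ψ₂.map OInst.zero) := by
  induction h with
  | nil => exact .nil
  | cons hA _ ih =>
    refine .cons (hA.mono ?_) ih
    rw [minWin_zero]
    refine min_le_min ?_ ?_ <;> split_ifs with h <;> simp_all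

theorem OAgree.split {above l Ψ₂ : List OInst} (h : OAgree ω p (above ++ l) Ψ₂) :
    ∃ above₂ l₂, Ψ₂ = above₂ ++ l₂ ∧ OAgree ω p l l₂ ∧
      List.Forall₂ (fun ψ₁ ψ₂ => ψ₁.ctr = ψ₂.ctr ∧ ψ₁.win = ψ₂.win) above above₂ := by
  induction above generalizing Ψ₂ with
  | nil => exact ⟨[], Ψ₂, rfl, h, .nil⟩
  | cons ψ above ih =>
    cases h with
    | cons hA h =>
      obtain ⟨above₂, l₂, rfl, hl, ha⟩ := ih h
      exact ⟨_ :: above₂, l₂, rfl, hl, .cons ⟨rfl, rfl⟩ ha⟩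

/-- An instance survives only as long as its own window and all windows below it last, so agreement
is needed only up to the minimum of these. A step lowers that minimum in the same way as the window
of `Agree`. For suspended instances, which lose window without executing anything, `Agree.mono`
suffices. -/
theorem OStep.agree {s₁ s₂ s₁' : List OInst} {τ : Trace} (hA : OAgree ω p s₁ s₂)
    (h : OStep ω O p s₁ τ s₁') : ∃ s₂', OStep ω O p s₂ τ s₂' ∧ OAgree ω p s₁' s₂' := by
  have hen := hA.enabled
  cases h with
  | @storeSkip c k σ₁ σ₁' h n w x e τ rest he hk hi hs ho =>
    have he₂ := hen he
    have hm := minWin_ne_zero_iff.2 he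
    cases hA with
    | cons hA hr =>
    obtain ⟨σ₂', hs', hb, he', -⟩ := hA.step hm hs
    have he' := he' fun h => by rw [hk, hi] at h; simp at h
    have hb := hb k x e hk hi
    rw [enat_min_sub_one] at he' hb
    refine ⟨_, .storeSkip he₂ (hA.pc_eq ▸ hk) hi hs' ho, .cons (hb.mono ?_)
      (.cons (by rwa [minWin_decr]) hr.decr)⟩
    -- The oracle's window satisfies `w ≤ ω`, and the minimum over the stack below is the `n` of
    -- `Agree.store`.
    rw [minWin, minWin_decr]
    exact min_le_min (by exact_mod_cast Nat.lt_succ_iff.1 w.2) le_rfl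
  | storeExec he hk hi hs ho =>
    have he₂ := hen he
    have hm := minWin_ne_zero_iff.2 he
    cases hA with
    | cons hA hr =>
    obtain ⟨σ₂', hs', hb, he', -⟩ := hA.step hm hs
    have he' := he' fun h => by rw [hk, hi] at h; simp at h
    rw [enat_min_sub_one] at he'
    exact ⟨_, .storeExec he₂ (hA.pc_eq ▸ hk) hi hs' ho, .cons (by rwa [minWin_decr]) hr.decr⟩
  | noSpec he hi hi' hs =>
    have he₂ := hen he
    have hm := minWin_ne_zero_iff.2 he
    cases hA with
    | cons hA hr =>
    obtain ⟨σ₂', hs', hb, he', -⟩ := hA.step hm hs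
    have he' := he' fun h => absurd h hi'
    rw [enat_min_sub_one] at he'
    exact ⟨_, .noSpec he₂ (hA.pc_eq ▸ hi) (hA.pc_eq ▸ hi') hs',
      .cons (by rwa [minWin_decr]) hr.decr⟩
  | @barrier c σ₁ σ₁' h n τ rest he hi hs =>
    have he₂ := hen he
    have hm := minWin_ne_zero_iff.2 he
    cases hA with
    | cons hA hr =>
    obtain ⟨σ₂', hs', -, he', hpc⟩ := hA.step hm hs
    refine ⟨_, .barrier he₂ (hA.pc_eq ▸ hi) hs', .cons ?_ hr.zero⟩
    simp only at he' ⊢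
    rw [minWin_zero]
    by_cases h : min n (minWin rest) = ⊤
    · rw [h] at he'
      exact (he' fun _ => rfl).mono le_top
    -- Some window at or below the top is finite and is set to `0` by the barrier, so a rollback is
    -- due and only the lines need to coincide.
    · have : min (if n = ⊤ then (⊤ : ℕ∞) else 0) (if minWin rest = ⊤ then ⊤ else 0) = 0 := by
        by_cases h₁ : n = ⊤ <;> by_cases h₂ : minWin rest = ⊤ <;> simp_all
      rw [this]
      exact .zero hpc
  | @rollback above rest ψ' ψ top he hw ht =>
    obtain ⟨above₂, l₂, rfl, hl, ha⟩ := hA.split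
    have he₂ : Enabled above₂ := by
      clear ht hen hA
      induction ha with
      | nil => exact he
      | cons h _ ih =>
        simp only [Enabled, List.mem_cons, forall_eq_or_imp] at he ih ⊢
        exact ⟨h.2 ▸ he.1, ih he.2⟩
    cases hl with
    | cons _ hl =>
    cases hl with
    | cons hB hl =>
    cases ha with
    | nil =>
      obtain rfl := by simpa using ht
      exact ⟨_, .rollback he₂ hw rfl, .cons hB hl⟩
    | cons h ha =>
      obtain rfl := by simpa using ht
      refine ⟨_, .rollback he₂ hw rfl, ?_⟩
      simp only [h.1]
      exact .cons hB hl
  | rollbackStuck he hs =>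
    have he₂ := hen he
    have hm := minWin_ne_zero_iff.2 he
    cases hA with
    | cons hA hr =>
    have hst := hA.stuck_right hm hs
    cases hr with
    | cons hB hl => exact ⟨_, .rollbackStuck he₂ hst, .cons hB hl⟩

theorem oracleGen.agree {σ₁ σ₂ : Config} {τ : Trace} (h : oracleGen ω O p σ₁ τ)
    (hA : Agree ω p ⊤ σ₁ σ₂) : oracleGen ω O p σ₂ τ := by
  obtain ⟨c, σ', hi, hs, hf⟩ := h
  obtain ⟨s₂', hs', h⟩ := hs.simulate (Rel := OAgree ω p) (fun _ _ _ _ h h' => h'.agree h)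
    (s₂ := [⟨0, σ₂, [], ⊤⟩]) (.cons (by simpa [minWin] using hA) .nil)
  cases h with
  | cons hB hr =>
  cases hr
  exact ⟨_, _, _, hs', hB.pc_eq.symm.trans hf⟩

/-! ### Oracles that lead to a given instance -/

/-- The oracle leads to the instances with history `h`, and predicts the maximal window for the
bypassed stores on the way. -/
def Follows (O : Oracle ω) (p : Program) (h : History) : Prop :=
  ∀ h' k b, h' ++ [(k, b)] <+: h → O p h' k = if b then some (Fin.last ω) else none

/-- Bypass exactly when this continues along a prefix of `h`, and execute every other store. -/
theorem exists_follows (ω : ℕ) (p : Program) (h : History) :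
    ∃ O : Oracle ω, Follows O p h := by
  classical
  refine ⟨fun _ h' k => if h' ++ [(k, true)] <+: h then some (Fin.last ω) else none, ?_⟩
  intro h' k b hb
  cases b with
  | true => simp [hb]
  | false =>
    -- Two prefixes of `h` of the same length are equal, so `h` cannot record both outcomes after
    -- `h'`.
    have : ¬ h' ++ [(k, true)] <+: h := fun ht => by
      simpa using (List.prefix_of_prefix_length_le hb ht (by simp)).eq_of_length (by simp)
    simp [this]

theorem Follows.of_append {h : History} {o : ℕ × Bool} (hO : Follows O p (h ++ [o])) :
    Follows O p h :=
  fun h' k b hp => hO h' k b (hp.trans (List.prefix_append _ _))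

theorem Follows.last {h : History} {k : ℕ} {b : Bool} (hO : Follows O p (h ++ [(k, b)])) :
    O p h k = if b then some (Fin.last ω) else none :=
  hO h k b (List.prefix_rfl)

/-- For all oracles that lead to history `h`, the stacks have terminating executions with the same
trace. -/
def OIndist (ω : ℕ) (p : Program) (h : History) (s₁ s₂ : List OInst) : Prop :=
  ∀ O : Oracle ω, Follows O p h → ∃ τ f₁ f₂, Steps (OStep ω O p) s₁ τ f₁ ∧
    Steps (OStep ω O p) s₂ τ f₂ ∧ OFinal f₁ ∧ OFinal f₂

/-- Passing to the longer history `h'` discards the oracles that decide the next store differently.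
All remaining ones take the same step, which determinism removes from the front of both runs. -/
theorem OIndist.step {h h' : History} {s₁ s₂ s₁' s₂' : List OInst} {τ : Trace}
    (hI : OIndist ω p h s₁ s₂) (hh : ∀ O : Oracle ω, Follows O p h' → Follows O p h)
    (hs : ∀ O : Oracle ω, Follows O p h' → OStep ω O p s₁ τ s₁' ∧ OStep ω O p s₂ τ s₂') :
    OIndist ω p h' s₁' s₂' := by
  intro O hO
  obtain ⟨τ₀, f₁, f₂, h₁, h₂, hf₁, hf₂⟩ := hI O (hh O hO)
  obtain ⟨hs₁, hs₂⟩ := hs O hO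
  obtain ⟨r, rfl, hr⟩ := h₁.tail (oStep_deterministic ω O p) hf₁.not_step hs₁
  obtain ⟨r', hr', hr₂⟩ := h₂.tail (oStep_deterministic ω O p) hf₂.not_step hs₂
  obtain rfl := List.append_cancel_left hr'
  exact ⟨r, f₁, f₂, hr, hr₂, hf₁, hf₂⟩

theorem not_stuck_of_run {c : ℕ} {h : History} {n : ℕ∞} {rest s₁' : List OInst}
    {σ₁ σ₂ σ₂' : Config} {τ₂ r τ : Trace}
    (hpc : σ₁.regs .pc = σ₂.regs .pc) (he : Enabled (⟨c, σ₁, h, n⟩ :: rest))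
    (h₁ : Steps (OStep ω O p) (⟨c, σ₁, h, n⟩ :: rest) τ s₁') (hf : OFinal s₁')
    (hs : NSStep p σ₂ τ₂ σ₂') (hτ : τ = τ₂ ++ r) : ¬ Stuck p σ₁ := by
  intro hst
  obtain ⟨o, t, rfl, ho⟩ := hst.obs_of_step hpc hs
  cases h₁ with
  | refl =>
    obtain ⟨_, _, _, heq, hf⟩ := hf
    cases heq
    exact absurd hs (Config.IsFinal.not_step (hpc.symm.trans hf))
  | head h₁ h₂ =>
    have := h₁.next
    simp only [oNext, if_pos he, if_pos hst] at this
    split at this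
    · cases this
    · cases this
      simp only [List.cons_append, List.cons.injEq] at hτ
      exact ho _ hτ.1.symm

/-- One oracle that follows `h` is enough: its two runs have the same trace, so the second instance
cannot be stuck in place of an observed step, and `NSStep.pair` then compares the two steps. -/
theorem OIndist.exists_step {c : ℕ} {h : History} {n : ℕ∞} {rest₁ rest₂ : List OInst}
    {σ₁ σ₂ σ₁' : Config} {τ : Trace}
    (hI : OIndist ω p h (⟨c, σ₁, h, n⟩ :: rest₁) (⟨c, σ₂, h, n⟩ :: rest₂))
    (hpc : σ₁.regs .pc = σ₂.regs .pc) (he₁ : Enabled (⟨c, σ₁, h, n⟩ :: rest₁))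
    (he₂ : Enabled (⟨c, σ₂, h, n⟩ :: rest₂)) (hs : NSStep p σ₁ τ σ₁') :
    ∃ σ₂', NSStep p σ₂ τ σ₂' ∧ σ₁'.regs .pc = σ₂'.regs .pc := by
  obtain ⟨O, hO⟩ := exists_follows ω p h
  obtain ⟨τ₀, f₁, f₂, h₁, h₂, hf₁, hf₂⟩ := hI O hO
  obtain ⟨τ₁, _, _, _, _, _, hs₁⟩ := hs.exists_oStep (ω := ω) (O := O) he₁
  obtain ⟨r, hr, -⟩ := h₁.tail (oStep_deterministic ω O p) hf₁.not_step hs₁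
  rw [List.append_assoc] at hr
  obtain ⟨τ₂, σ₂', hs'⟩ := not_not.1 (not_stuck_of_run hpc.symm he₂ h₂ hf₂ hs hr)
  obtain ⟨τ₃, _, _, _, _, _, hs₂⟩ := hs'.exists_oStep (ω := ω) (O := O) he₂
  obtain ⟨r', hr', -⟩ := h₂.tail (oStep_deterministic ω O p) hf₂.not_step hs₂
  rw [hr, List.append_assoc] at hr'
  obtain ⟨rfl, hpc'⟩ := hs.pair hpc hs' hr'
  exact ⟨σ₂', hs', hpc'⟩

theorem OIndist.symm {h : History} {s₁ s₂ : List OInst} (hI : OIndist ω p h s₁ s₂) :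
    OIndist ω p h s₂ s₁ := by
  intro O hO
  obtain ⟨τ, f₁, f₂, h₁, h₂, hf₁, hf₂⟩ := hI O hO
  exact ⟨τ, f₂, f₁, h₂, h₁, hf₂, hf₁⟩

theorem Enabled.of_le {n : ℕ∞} {Ψ : List OInst} (hn : n ≠ 0) (h : ∀ ψ ∈ Ψ, n ≤ ψ.win) :
    Enabled Ψ := by
  intro ψ hψ h0
  have := h ψ hψ
  rw [h0] at this
  exact hn (nonpos_iff_eq_zero.1 this)

theorem le_win_decr {n : ℕ∞} {Ψ : List OInst} (h : ∀ ψ ∈ Ψ, n + 1 ≤ ψ.win) :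
    ∀ ψ ∈ Ψ.map OInst.decr, n ≤ ψ.win := by
  intro ψ hψ
  obtain ⟨ψ, hψ', rfl⟩ := List.mem_map.1 hψ
  simpa [enat_add_one_sub_one, OInst.decr] using tsub_le_tsub_right (h ψ hψ') 1

/-- The derivation `hA` only supplies the finite tree of `σ₁` to recurse on; its partner `σ₀` plays
no role. At each node the oracles that lead there have indistinguishable runs. Since `n` bounds
every window on the stack from below, no rollback is due to an exhausted window before the
always-mispredict window `n` is spent. -/
theorem Agree.of_oIndist {n : ℕ∞} {σ₁ σ₀ : Config} (hA : Agree ω p n σ₁ σ₀) {σ₂ : Config}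
    {c : ℕ} {h : History} {w : ℕ∞} {r₁ r₂ : List OInst} (hpc : σ₁.regs .pc = σ₂.regs .pc)
    (hw₁ : ∀ ψ ∈ (⟨c, σ₁, h, w⟩ :: r₁ : List OInst), n ≤ ψ.win)
    (hw₂ : ∀ ψ ∈ (⟨c, σ₂, h, w⟩ :: r₂ : List OInst), n ≤ ψ.win)
    (ht : n = ⊤ → r₁ = [] ∧ r₂ = [])
    (hI : OIndist ω p h (⟨c, σ₁, h, w⟩ :: r₁) (⟨c, σ₂, h, w⟩ :: r₂)) :
    Agree ω p n σ₁ σ₂ := by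
  induction hA generalizing σ₂ c h w r₁ r₂ with
  | zero => exact .zero hpc
  | @stuck n _ _ hn _ hs =>
    by_cases h0 : n = 0
    · subst h0; exact .zero hpc
    refine .stuck hn hpc hs ?_
    rintro ⟨τ, σ₂', hs'⟩
    obtain ⟨σ₁', hs'', -⟩ := hI.symm.exists_step hpc.symm (.of_le h0 hw₂) (.of_le h0 hw₁) hs'
    exact hs ⟨_, _, hs''⟩
  | final hf => exact .final hf (hpc.symm.trans hf)
  | @store n σ₁ _ σ₁' _ τ k x e hk _ hi hs _ _ _ ihb ihe =>
    have he₁ := Enabled.of_le (by simp) hw₁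
    have he₂ := Enabled.of_le (by simp) hw₂
    obtain ⟨σ₂', hs', hpc'⟩ := hI.exists_step hpc he₁ he₂ hs
    have hd₁ := le_win_decr hw₁
    have hd₂ := le_win_decr hw₂
    have hk₂ := hpc ▸ hk
    refine .store hk hk₂ hi hs hs' ?_ ?_
    -- The bypass branch keeps the oracles that bypass after `h`. They open the window `ω`, and the
    -- suspended windows are at least `n`, so `min ω n` is again a lower bound.
    · refine ihb (c := c + 1) (h := h ++ [(k, true)]) (w := ω)
        (r₁ := ⟨c, σ₁', h ++ [(k, false)], w - 1⟩ :: r₁.map OInst.decr)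
        (r₂ := ⟨c, σ₂', h ++ [(k, false)], w - 1⟩ :: r₂.map OInst.decr)
        (by simp [Config.skipAt_pc]) ?_ ?_ (by simp) ?_
      · simp only [List.map_cons, OInst.decr, List.mem_cons, forall_eq_or_imp] at hd₁ ⊢
        exact ⟨min_le_left _ _, min_le_of_right_le hd₁.1, fun ψ hψ => min_le_of_right_le (hd₁.2 ψ hψ)⟩
      · simp only [List.map_cons, OInst.decr, List.mem_cons, forall_eq_or_imp] at hd₂ ⊢
        exact ⟨min_le_left _ _, min_le_of_right_le hd₂.1, fun ψ hψ => min_le_of_right_le (hd₂.2 ψ hψ)⟩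
      · refine hI.step (τ := τ ++ [.start c, .skip k]) (fun O hO => hO.of_append) fun O hO => ?_
        have ho : O p h k = some (Fin.last ω) := hO.last
        exact ⟨.storeSkip he₁ hk hi hs ho, .storeSkip he₂ hk₂ hi hs' ho⟩
    -- The executed branch keeps the oracles that execute the store after `h`; it is reached
    -- directly, without first waiting for a bypass to be rolled back.
    · refine ihe (c := c) (h := h ++ [(k, false)]) (w := w - 1)
        (r₁ := r₁.map OInst.decr) (r₂ := r₂.map OInst.decr) hpc' ?_ ?_ ?_ ?_
      · simpa [OInst.decr] using hd₁
      · simpa [OInst.decr] using hd₂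
      · rintro rfl; simpa using ht
      · refine hI.step (τ := τ) (fun O hO => hO.of_append) fun O hO => ?_
        have ho : O p h k = none := hO.last
        exact ⟨.storeExec he₁ hk hi hs ho, .storeExec he₂ hk₂ hi hs' ho⟩
  | @noSpec n σ₁ _ σ₁' _ τ _ hi hi' hs _ _ ih =>
    have he₁ := Enabled.of_le (by simp) hw₁
    have he₂ := Enabled.of_le (by simp) hw₂
    obtain ⟨σ₂', hs', hpc'⟩ := hI.exists_step hpc he₁ he₂ hs
    refine .noSpec hpc hi hi' hs hs' (ih (c := c) (h := h) (w := w - 1)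
      (r₁ := r₁.map OInst.decr) (r₂ := r₂.map OInst.decr) hpc' ?_ ?_ ?_ ?_)
    · simpa [OInst.decr] using le_win_decr hw₁
    · simpa [OInst.decr] using le_win_decr hw₂
    · rintro rfl; simpa using ht
    · exact hI.step (fun O hO => hO) fun O _ =>
        ⟨.noSpec he₁ hi hi' hs, .noSpec he₂ (hpc ▸ hi) (hpc ▸ hi') hs'⟩
  | @barrier σ₁ _ σ₁' _ τ _ hi hs _ _ ih =>
    have he₁ := Enabled.of_le (by simp) hw₁
    have he₂ := Enabled.of_le (by simp) hw₂
    obtain ⟨σ₂', hs', hpc'⟩ := hI.exists_step hpc he₁ he₂ hs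
    -- With `n = ⊤` nothing lies below the instance and its own window is `⊤`, so the barrier has no
    -- effect on windows.
    obtain ⟨rfl, rfl⟩ := ht rfl
    obtain rfl : w = ⊤ := by simpa using hw₁
    exact .barrier hpc hi hs hs' (ih (c := c) (h := h) (w := ⊤) hpc' (by simp) (by simp)
      (fun _ => ⟨rfl, rfl⟩) (hI.step (fun O hO => hO) fun O _ =>
        ⟨.barrier he₁ hi hs, .barrier he₂ (hpc ▸ hi) hs'⟩))
  | @barrierSpec n σ₁ _ _ _ _ hn _ hi hs =>
    by_cases h0 : n = 0
    · subst h0; exact .zero hpc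
    obtain ⟨σ₂', hs', -⟩ := hI.exists_step hpc (.of_le h0 hw₁) (.of_le h0 hw₂) hs
    exact .barrierSpec hn hpc hi hs hs'

theorem agree_of_oracleGen {σ₁ σ₂ : Config} (hpc : σ₁.regs .pc = σ₂.regs .pc)
    (hσ : Agree ω p ⊤ σ₁ σ₁)
    (h : ∀ O : Oracle ω, ∃ τ, oracleGen ω O p σ₁ τ ∧ oracleGen ω O p σ₂ τ) :
    Agree ω p ⊤ σ₁ σ₂ := by
  refine hσ.of_oIndist (c := 0) (h := []) (w := ⊤) hpc (by simp) (by simp)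
    (fun _ => ⟨rfl, rfl⟩) fun O _ => ?_
  obtain ⟨τ, h₁, h₂⟩ := h O
  obtain ⟨f₁, h₁, hf₁⟩ := oracleGen_iff.1 h₁
  obtain ⟨f₂, h₂, hf₂⟩ := oracleGen_iff.1 h₂
  exact ⟨τ, f₁, f₂, h₁, h₂, hf₁, hf₂⟩

/-! ### Non-interference -/

/-- In both directions, equal traces in one semantics give agreement with window `⊤`, agreement
transports the run in the other semantics, and determinism identifies the transported trace with the
given one. -/
theorem sni_oracle_iff (pol : Policy) :
    (∀ O : Oracle ω, SNI (oracleGen ω O) pol p) ↔ SNI (amGen ω) pol p := by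
  constructor
  · intro h σ₁ σ₂ hi₁ hi₂ hl τ₁ τ₂ h₁ h₂ hτ
    have hpc := hi₁.trans hi₂.symm
    obtain ⟨f, hs, hf⟩ := h₁.project
    have hA : Agree ω p ⊤ σ₁ σ₂ := by
      refine agree_of_oracleGen hpc (.refl_of_steps hs hf) fun O => ?_
      obtain ⟨τ₁', h₁'⟩ := exists_oracleGen h₁.project O
      obtain ⟨τ₂', h₂'⟩ := exists_oracleGen h₂.project O
      -- The oracle trace and the always-mispredict trace from a configuration both project to its
      -- unique non-speculative trace, so the hypothesis on projections carries over.
      have := h O σ₁ σ₂ hi₁ hi₂ hl τ₁' τ₂' h₁' h₂' (by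
        rw [nsGen_unique h₁'.project h₁.project, nsGen_unique h₂'.project h₂.project, hτ])
      exact ⟨τ₁', h₁', this ▸ h₂'⟩
    exact amGen_unique (h₁.agree hA) h₂
  · intro h O σ₁ σ₂ hi₁ hi₂ hl τ₁ τ₂ h₁ h₂ hτ
    obtain ⟨τ₁', h₁'⟩ := exists_amGen (ω := ω) h₁.project
    obtain ⟨τ₂', h₂'⟩ := exists_amGen (ω := ω) h₂.project
    have := h σ₁ σ₂ hi₁ hi₂ hl τ₁' τ₂' h₁' h₂' (by
      rw [nsGen_unique h₁'.project h₁.project, nsGen_unique h₂'.project h₂.project, hτ])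
    subst this
    exact oracleGen_unique (h₁.agree (agree_of_amGen (hi₁.trans hi₂.symm) h₁' h₂')) h₂

/-- For the inclusion from right to left, extend the non-speculative run to a speculative one from
the same configuration; uniqueness of the non-speculative trace shows that it projects back to the
given one. -/
theorem nspecProject_image_behaviour {gen : Program → Config → Trace → Prop}
    (hg : ∀ σ τ, gen p σ τ → nsGen p σ (nspecProject τ))
    (hn : ∀ σ τ, nsGen p σ τ → ∃ τ', gen p σ τ') :
    nspecProject '' behaviour gen p = behaviour nsGen p := by
  ext τ
  constructor
  · rintro ⟨τ, ⟨σ, hi, h⟩, rfl⟩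
    exact ⟨σ, hi, hg σ τ h⟩
  · rintro ⟨σ, hi, h⟩
    obtain ⟨τ', h'⟩ := hn σ τ h
    exact ⟨τ', ⟨σ, hi, h'⟩, nsGen_unique (hg σ τ' h') h⟩

/-! ## The symbolic semantics -/

def SymConfig.eval (μ : Valuation) (σ : SymConfig) : Config :=
  ⟨σ.mem.eval μ, fun x => (σ.regs x).eval μ⟩

/-- The program counter is a constant. -/
def SymConfig.ConcretePc (σ : SymConfig) : Prop := ∃ v, σ.regs .pc = .const v

theorem SymConfig.eval_pc {μ : Valuation} {σ : SymConfig} {v : Val} (h : σ.regs .pc = .const v) :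
    (σ.eval μ).regs .pc = v := by
  simp [SymConfig.eval, h, SymExpr.eval]

theorem SymConfig.ConcretePc.pc_eq {μ : Valuation} {σ : SymConfig} (h : σ.ConcretePc) :
    σ.regs .pc = .const ((σ.eval μ).regs .pc) := by
  obtain ⟨v, hv⟩ := h
  rw [SymConfig.eval_pc hv, hv]

theorem Expr.eval_symEval (μ : Valuation) (a : SymRegFile) (e : Expr) :
    (e.symEval a).eval μ = e.eval fun x => (a x).eval μ := by
  induction e with
  | lit | reg => simp [Expr.symEval, Expr.eval, SymExpr.eval]
  | un f e ih => simp [Expr.symEval, Expr.eval, SymExpr.eval, ih]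
  | bin f e₁ e₂ ih₁ ih₂ => simp [Expr.symEval, Expr.eval, SymExpr.eval, ih₁, ih₂]

theorem eval_update (μ : Valuation) (a : SymRegFile) (x : Reg) (e : SymExpr) :
    (fun y => (Function.update a x e y).eval μ)
      = Function.update (fun y => (a y).eval μ) x (e.eval μ) := by
  ext1 y
  exact Function.apply_update (fun _ (e : SymExpr) => e.eval μ) a x e y

theorem eval_symSetPc (μ : Valuation) (a : SymRegFile) (v : Val) :
    (fun y => (symSetPc a v y).eval μ) = setPc (fun y => (a y).eval μ) v := by
  rw [symSetPc, eval_update, SymExpr.eval, setPc]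

theorem pathSat_append {μ : Valuation} {t t' : SymTrace} :
    PathSat μ (t ++ t') ↔ PathSat μ t ∧ PathSat μ t' := by
  simp only [PathSat, List.mem_append]
  exact ⟨fun h => ⟨fun φ hφ => h φ (.inl hφ), fun φ hφ => h φ (.inr hφ)⟩,
    fun h φ hφ => hφ.elim (h.1 φ) (h.2 φ)⟩

theorem pathSat_nil {μ : Valuation} : PathSat μ [] := by simp [PathSat]

/-- Assignments and loads to the program counter are excluded, and computed jump targets are guessed
as constants, with the guess recorded as a path constraint. -/
theorem SymStep.concretePc {σ σ' : SymConfig} {t : SymTrace} (h : SymStep p σ t σ') :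
    σ'.ConcretePc := by
  cases h <;> simp [SymConfig.ConcretePc, symSetPc, Function.update, *] <;> simp_all [eq_comm]

theorem eval_skipAt (μ : Valuation) (σ : SymConfig) (k : ℕ) :
    (σ.skipAt k).eval μ = (σ.eval μ).skipAt k := by
  simp [SymConfig.skipAt, Config.skipAt, SymConfig.eval, eval_symSetPc]

theorem concretePc_skipAt (σ : SymConfig) (k : ℕ) : (σ.skipAt k).ConcretePc :=
  ⟨some (k + 1), by simp [SymConfig.skipAt, symSetPc]⟩

theorem SymStep.eval {μ : Valuation} {σ σ' : SymConfig} {t : SymTrace} (h : SymStep p σ t σ')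
    (ht : PathSat μ t) : NSStep p (σ.eval μ) (t.filterMap (SymObs.eval μ)) (σ'.eval μ) := by
  cases h with
  | @skip m a _ hk hi =>
    simpa [SymConfig.eval, eval_symSetPc] using NSStep.skip (SymConfig.eval_pc (σ := ⟨m, a⟩) hk) hi
  | @spbarr m a _ hk hi =>
    simpa [SymConfig.eval, eval_symSetPc] using
      NSStep.spbarr (SymConfig.eval_pc (σ := ⟨m, a⟩) hk) hi
  | @assign m a _ _ _ hk hi hx =>
    simpa [SymConfig.eval, eval_symSetPc, eval_update, Expr.eval_symEval] using
      NSStep.assign (SymConfig.eval_pc (σ := ⟨m, a⟩) hk) hi hx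
  | @condAssign m a k x e c hk hi hx =>
    have hk := SymConfig.eval_pc (μ := μ) (σ := ⟨m, a⟩) hk
    by_cases hc : c.eval (fun x => (a x).eval μ) = some 0
    · simpa [SymConfig.eval, eval_symSetPc, eval_update, Expr.eval_symEval, SymExpr.eval, hc] using
        NSStep.condAssignSat hk hi hx hc
    -- The symbolic rule writes the old value back to `x` when the condition fails. As `x` is not
    -- the program counter, this leaves the register file as it is.
    · have hu : Function.update (setPc (fun y => (a y).eval μ) (some (k + 1))) x ((a x).eval μ)
          = setPc (fun y => (a y).eval μ) (some (k + 1)) :=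
        Function.update_eq_self_iff.2 (by simp [setPc, hx])
      simpa [SymConfig.eval, eval_symSetPc, eval_update, Expr.eval_symEval, SymExpr.eval, hc, hu]
        using NSStep.condAssignUnsat hk hi hx hc
  | @load m a k x e hk hi hx =>
    have hk := SymConfig.eval_pc (μ := μ) (σ := ⟨m, a⟩) hk
    obtain ⟨n, hn⟩ := Option.ne_none_iff_exists'.1 (ht _ (List.mem_cons_self ..))
    rw [Expr.eval_symEval] at hn
    simpa [SymConfig.eval, eval_symSetPc, eval_update, Expr.eval_symEval, SymExpr.eval, hn,
      SymObs.eval, List.filterMap_cons] using NSStep.load hk hi hx hn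
  | @store m a k x e hk hi =>
    have hk := SymConfig.eval_pc (μ := μ) (σ := ⟨m, a⟩) hk
    obtain ⟨n, hn⟩ := Option.ne_none_iff_exists'.1 (ht _ (List.mem_cons_self ..))
    rw [Expr.eval_symEval] at hn
    simpa [SymConfig.eval, eval_symSetPc, Expr.eval_symEval, SymMem.eval, hn,
      SymObs.eval, List.filterMap_cons] using NSStep.store hk hi hn
  | @jmp m a k e l hk hi =>
    have hk := SymConfig.eval_pc (μ := μ) (σ := ⟨m, a⟩) hk
    have hl : (e.symEval a).eval μ = l := ht _ (List.mem_cons_self ..)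
    rw [Expr.eval_symEval] at hl
    simpa [SymConfig.eval, eval_symSetPc, SymObs.eval, List.filterMap_cons, hl] using NSStep.jmp hk hi
  | @beqzSat m a k x l hk hi =>
    have hk := SymConfig.eval_pc (μ := μ) (σ := ⟨m, a⟩) hk
    simpa [SymConfig.eval, eval_symSetPc, SymObs.eval, List.filterMap_cons] using
      NSStep.beqzSat hk hi (ht _ (List.mem_cons_self ..))
  | @beqzUnsat m a k x l hk hi =>
    have hk := SymConfig.eval_pc (μ := μ) (σ := ⟨m, a⟩) hk
    simpa [SymConfig.eval, eval_symSetPc, SymObs.eval, List.filterMap_cons] using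
      NSStep.beqzUnsat hk hi (ht _ (List.mem_cons_self ..))
  | @call m a k f l hk hi hl =>
    have hk := SymConfig.eval_pc (μ := μ) (σ := ⟨m, a⟩) hk
    obtain ⟨n, hn⟩ := Option.ne_none_iff_exists'.1 (ht _ (List.mem_cons_self ..))
    rw [SymExpr.eval] at hn
    simpa [SymConfig.eval, eval_symSetPc, eval_update, SymExpr.eval, SymMem.eval, hn,
      SymObs.eval, List.filterMap_cons] using NSStep.call hk hi hl hn
  | @ret m a k l hk hi =>
    have hk := SymConfig.eval_pc (μ := μ) (σ := ⟨m, a⟩) hk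
    obtain ⟨n, hn⟩ := Option.ne_none_iff_exists'.1 (ht _ (List.mem_cons_self ..))
    have hl : (SymExpr.read m (a .sp)).eval μ = l := ht (.eq (.read m (a .sp)) l) (by simp)
    rw [SymExpr.eval, hn] at hl
    simpa [SymConfig.eval, eval_symSetPc, eval_update, SymExpr.eval, hl, SymObs.eval, List.filterMap_cons] using
      NSStep.ret (m := m.eval μ) hk hi hn
  | @terminate m a _ hk hi =>
    simpa [SymConfig.eval, eval_symSetPc] using
      NSStep.terminate (SymConfig.eval_pc (σ := ⟨m, a⟩) hk) hi

/-- A symbolic step whose path constraints hold is the concretization of the given step. -/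
theorem exists_symStep_of_symStep {μ : Valuation} {σ σs : SymConfig} {σ' : Config} {τ : Trace}
    {t : SymTrace} (h : NSStep p (σ.eval μ) τ σ') (h' : SymStep p σ t σs) (ht : PathSat μ t) :
    ∃ t σs, SymStep p σ t σs ∧ PathSat μ t ∧ τ = t.filterMap (SymObs.eval μ) ∧
      σ' = σs.eval μ := by
  obtain ⟨h₁, h₂⟩ := nsStep_deterministic p h (h'.eval ht)
  exact ⟨t, σs, h', ht, h₁, h₂⟩

/-- It suffices to exhibit any symbolic step whose constraints hold: its concretization is a step
from the same configuration, and determinism identifies the outcomes. -/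
theorem NSStep.exists_symStep {μ : Valuation} {σ : SymConfig} {σ' : Config} {τ : Trace}
    (hσ : σ.ConcretePc) (h : NSStep p (σ.eval μ) τ σ') :
    ∃ t σs, SymStep p σ t σs ∧ PathSat μ t ∧ τ = t.filterMap (SymObs.eval μ) ∧
      σ' = σs.eval μ := by
  have h₀ := h
  have hpc := hσ.pc_eq (μ := μ)
  obtain ⟨m, a⟩ := σ
  have hP {v} (h : (SymConfig.eval μ ⟨m, a⟩).regs .pc = v) : a .pc = .const v := h ▸ hpc
  generalize hc : SymConfig.eval μ ⟨m, a⟩ = c at h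
  cases h with
  | skip hk hi =>
    obtain ⟨rfl, rfl⟩ := Config.mk.inj hc
    exact exists_symStep_of_symStep h₀ (.skip (hP hk) hi) pathSat_nil
  | spbarr hk hi =>
    obtain ⟨rfl, rfl⟩ := Config.mk.inj hc
    exact exists_symStep_of_symStep h₀ (.spbarr (hP hk) hi) pathSat_nil
  | assign hk hi hx =>
    obtain ⟨rfl, rfl⟩ := Config.mk.inj hc
    exact exists_symStep_of_symStep h₀ (.assign (hP hk) hi hx) pathSat_nil
  | condAssignSat hk hi hx h =>
    obtain ⟨rfl, rfl⟩ := Config.mk.inj hc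
    exact exists_symStep_of_symStep h₀ (.condAssign (hP hk) hi hx) pathSat_nil
  | condAssignUnsat hk hi hx h =>
    obtain ⟨rfl, rfl⟩ := Config.mk.inj hc
    exact exists_symStep_of_symStep h₀ (.condAssign (hP hk) hi hx) pathSat_nil
  | load hk hi hx hn =>
    obtain ⟨rfl, rfl⟩ := Config.mk.inj hc
    refine exists_symStep_of_symStep h₀ (.load (hP hk) hi hx) ?_
    simp [PathSat, PathCond.Holds, Expr.eval_symEval, hn]
  | store hk hi hn =>
    obtain ⟨rfl, rfl⟩ := Config.mk.inj hc
    refine exists_symStep_of_symStep h₀ (.store (hP hk) hi) ?_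
    simp [PathSat, PathCond.Holds, Expr.eval_symEval, hn]
  | @jmp _ _ _ e hk hi =>
    obtain ⟨rfl, rfl⟩ := Config.mk.inj hc
    refine exists_symStep_of_symStep h₀ (.jmp (e.eval fun x => (a x).eval μ) (hP hk) hi) ?_
    simp [PathSat, PathCond.Holds, Expr.eval_symEval]
  | beqzSat hk hi hx =>
    obtain ⟨rfl, rfl⟩ := Config.mk.inj hc
    refine exists_symStep_of_symStep h₀ (.beqzSat (hP hk) hi) ?_
    simp [PathSat, PathCond.Holds, hx]
  | beqzUnsat hk hi hx =>
    obtain ⟨rfl, rfl⟩ := Config.mk.inj hc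
    refine exists_symStep_of_symStep h₀ (.beqzUnsat (hP hk) hi) ?_
    simp [PathSat, PathCond.Holds, hx]
  | call hk hi hl hn =>
    obtain ⟨rfl, rfl⟩ := Config.mk.inj hc
    refine exists_symStep_of_symStep h₀ (.call (hP hk) hi hl) ?_
    simp [PathSat, PathCond.Holds, SymExpr.eval, hn]
  | @ret _ _ _ n hk hi hn =>
    obtain ⟨rfl, rfl⟩ := Config.mk.inj hc
    refine exists_symStep_of_symStep h₀ (.ret (m.eval μ n) (hP hk) hi) ?_
    simp [PathSat, PathCond.Holds, SymExpr.eval, hn]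
  | terminate hk hi =>
    obtain ⟨rfl, rfl⟩ := Config.mk.inj hc
    exact exists_symStep_of_symStep h₀ (.terminate (hP hk) hi) pathSat_nil

theorem SymStuck.eval {μ : Valuation} {σ : SymConfig} {t : SymTrace} (h : SymStuck p σ t)
    (ht : PathSat μ t) : Stuck p (σ.eval μ) ∧ t.filterMap (SymObs.eval μ) = [] := by
  cases h <;> rename_i m a hk <;>
    simp only [PathSat, List.mem_singleton, SymObs.symPc.injEq, forall_eq, PathCond.Holds,
      Expr.eval_symEval, SymExpr.eval] at ht <;>
    simp [SymObs.eval, stuck_iff, nsNext, SymConfig.eval, SymExpr.eval, *]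

/-- Each way for `nsNext` to fail is either visible in the program and the line, or is an operand
equal to `⊥`, which is a path constraint. -/
theorem Stuck.exists_symStuck {μ : Valuation} {σ : SymConfig}
    (hσ : σ.ConcretePc) (h : Stuck p (σ.eval μ)) :
    ∃ t, SymStuck p σ t ∧ PathSat μ t := by
  have hpc := hσ.pc_eq (μ := μ)
  obtain ⟨m, a⟩ := σ
  rw [stuck_iff, nsNext] at h
  split at h
  · rename_i hk
    exact ⟨_, .final (hk ▸ hpc), pathSat_nil⟩
  · rename_i k hk
    rw [hk] at hpc
    split at h <;> rename_i hi
    · cases h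
    · cases h
    · cases h
    · split_ifs at h with hx
      subst hx; exact ⟨_, .assign hpc hi, pathSat_nil⟩
    · split_ifs at h with hx
      subst hx; exact ⟨_, .condAssign hpc hi, pathSat_nil⟩
    · split_ifs at h with hx
      · subst hx; exact ⟨_, .loadPc hpc hi, pathSat_nil⟩
      · refine ⟨_, .load hpc hi, ?_⟩
        simpa [SymConfig.eval, PathSat, PathCond.Holds, Expr.eval_symEval] using Option.map_eq_none_iff.1 h
    · refine ⟨_, .store hpc hi, ?_⟩
      simpa [SymConfig.eval, PathSat, PathCond.Holds, Expr.eval_symEval] using Option.map_eq_none_iff.1 h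
    · cases h
    · split_ifs at h
    · rename_i f
      rcases hl : p.fn f with _ | l
      · exact ⟨_, .callUndef hpc hi hl, pathSat_nil⟩
      · refine ⟨_, .call hpc hi, ?_⟩
        rw [hl, Option.bind_some] at h
        simpa [SymConfig.eval, PathSat, PathCond.Holds, SymExpr.eval] using Option.map_eq_none_iff.1 h
    · refine ⟨_, .ret hpc hi, ?_⟩
      simpa [SymConfig.eval, PathSat, PathCond.Holds] using Option.map_eq_none_iff.1 h

-- Evaluation and lifting of symbolic always-mispredict runs

def SymInst.eval (μ : Valuation) (ψ : SymInst) : Inst := ⟨ψ.ctr, ψ.conf.eval μ, ψ.win⟩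

theorem SymAMStep.concretePc {s s' : List SymInst} {t : SymTrace} (h : SymAMStep ω p s t s')
    (hs : ∀ ψ ∈ s, ψ.conf.ConcretePc) : ∀ ψ ∈ s', ψ.conf.ConcretePc := by
  cases h with
  | store _ _ h =>
    simp only [List.mem_cons, forall_eq_or_imp] at hs ⊢
    exact ⟨concretePc_skipAt _ _, h.concretePc, hs.2⟩
  | noSpec _ _ _ h | barrier _ _ h | barrierSpec _ _ h =>
    simp only [List.mem_cons, forall_eq_or_imp] at hs ⊢
    exact ⟨h.concretePc, hs.2⟩
  | rollback | rollbackStuck =>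
    simp only [List.mem_cons, forall_eq_or_imp] at hs ⊢
    exact hs.2

theorem SymAMStep.eval {μ : Valuation} {s s' : List SymInst} {t : SymTrace}
    (h : SymAMStep ω p s t s') (ht : PathSat μ t) :
    AMStep ω p (s.map (SymInst.eval μ)) (t.filterMap (SymObs.eval μ))
      (s'.map (SymInst.eval μ)) := by
  cases h with
  | store hk hi h =>
    have h' := h.eval (pathSat_append.1 ht).1
    simpa [SymObs.eval, SymInst.eval, eval_skipAt] using
      AMStep.store (SymConfig.eval_pc hk) hi h'
  | noSpec hv hi hi' h =>
    have hv := SymConfig.eval_pc (μ := μ) hv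
    exact .noSpec (hv ▸ hi) (hv ▸ hi') (h.eval ht)
  | barrier hv hi h =>
    have hv := SymConfig.eval_pc (μ := μ) hv
    exact .barrier (hv ▸ hi) (h.eval ht)
  | barrierSpec hv hi h =>
    have hv := SymConfig.eval_pc (μ := μ) hv
    exact .barrierSpec (hv ▸ hi) (h.eval ht)
  | rollback => exact .rollback (.inl rfl)
  | rollbackStuck h =>
    obtain ⟨hs, h'⟩ := h.eval (pathSat_append.1 ht).1
    simpa [SymObs.eval, SymInst.eval, h'] using AMStep.rollback (.inr hs)

theorem AMStep.exists_symAMStep {μ : Valuation} {s : List SymInst} {s' : List Inst} {τ : Trace}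
    (hs : ∀ ψ ∈ s, ψ.conf.ConcretePc) (h : AMStep ω p (s.map (SymInst.eval μ)) τ s') :
    ∃ t s'', SymAMStep ω p s t s'' ∧ PathSat μ t ∧ τ = t.filterMap (SymObs.eval μ) ∧
      s' = s''.map (SymInst.eval μ) := by
  generalize hS : s.map (SymInst.eval μ) = S at h
  obtain _ | ⟨⟨c, σ, n⟩, rest⟩ := s
  · subst hS; cases h
  have hσ : σ.ConcretePc := hs ⟨c, σ, n⟩ (by simp)
  cases h with
  | store hk hi h =>
    simp only [List.map_cons, List.cons.injEq, SymInst.eval, Inst.mk.injEq] at hS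
    obtain ⟨⟨rfl, rfl, rfl⟩, rfl⟩ := hS
    obtain ⟨t, σs, h', ht, rfl, rfl⟩ := h.exists_symStep hσ
    refine ⟨_, _, .store (hk ▸ hσ.pc_eq (μ := μ)) hi h', pathSat_append.2 ⟨ht, ?_⟩, ?_, ?_⟩
    · simp [PathSat]
    · simp [SymObs.eval]
    · simp [SymInst.eval, eval_skipAt]
  | noSpec hi hi' h =>
    simp only [List.map_cons, List.cons.injEq, SymInst.eval, Inst.mk.injEq] at hS
    obtain ⟨⟨rfl, rfl, rfl⟩, rfl⟩ := hS
    obtain ⟨t, σs, h', ht, rfl, rfl⟩ := h.exists_symStep hσ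
    exact ⟨_, _, .noSpec hσ.pc_eq hi hi' h', ht, rfl, rfl⟩
  | barrier hi h =>
    simp only [List.map_cons, List.cons.injEq, SymInst.eval, Inst.mk.injEq] at hS
    obtain ⟨⟨rfl, rfl, rfl⟩, rfl⟩ := hS
    obtain ⟨t, σs, h', ht, rfl, rfl⟩ := h.exists_symStep hσ
    exact ⟨_, _, .barrier hσ.pc_eq hi h', ht, rfl, rfl⟩
  | barrierSpec hi h =>
    simp only [List.map_cons, List.cons.injEq, SymInst.eval, Inst.mk.injEq] at hS
    obtain ⟨⟨rfl, rfl, rfl⟩, rfl⟩ := hS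
    obtain ⟨t, σs, h', ht, rfl, rfl⟩ := h.exists_symStep hσ
    exact ⟨_, _, .barrierSpec hσ.pc_eq hi h', ht, rfl, rfl⟩
  | @rollback _ _ _ _ _ n' _ h =>
    obtain _ | ⟨⟨c', σ', n'⟩, rest⟩ := rest
    · simp at hS
    simp only [List.map_cons, List.cons.injEq, SymInst.eval, Inst.mk.injEq] at hS
    obtain ⟨⟨rfl, rfl, rfl⟩, ⟨rfl, rfl, rfl⟩, rfl⟩ := hS
    -- The concrete rollback rule splits into two symbolic ones, because a rollback of a stuck
    -- instance must record why it is stuck.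
    rcases h with rfl | h
    · exact ⟨_, _, .rollback, by simp [PathSat], rfl, rfl⟩
    · obtain ⟨t, h', ht⟩ := h.exists_symStuck hσ
      refine ⟨_, _, .rollbackStuck h', pathSat_append.2 ⟨ht, by simp [PathSat]⟩, ?_, rfl⟩
      simp [(h'.eval ht).2, SymObs.eval]

theorem Steps.eval {μ : Valuation} {s s' : List SymInst} {t : SymTrace}
    (h : Steps (SymAMStep ω p) s t s') (ht : PathSat μ t) :
    Steps (AMStep ω p) (s.map (SymInst.eval μ)) (t.filterMap (SymObs.eval μ))
      (s'.map (SymInst.eval μ)) := by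
  induction h with
  | refl => exact .refl _
  | head h _ ih =>
    obtain ⟨ht, ht'⟩ := pathSat_append.1 ht
    rw [List.filterMap_append]
    exact .head (h.eval ht) (ih ht')

theorem Steps.exists_symSteps {μ : Valuation} {s : List SymInst} {S S' : List Inst} {τ : Trace}
    (h : Steps (AMStep ω p) S τ S') (hs : ∀ ψ ∈ s, ψ.conf.ConcretePc)
    (hS : s.map (SymInst.eval μ) = S) :
    ∃ t s', Steps (SymAMStep ω p) s t s' ∧ PathSat μ t ∧ τ = t.filterMap (SymObs.eval μ) ∧
      S' = s'.map (SymInst.eval μ) ∧ ∀ ψ ∈ s', ψ.conf.ConcretePc := by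
  induction h generalizing s with
  | refl => exact ⟨[], s, .refl _, pathSat_nil, rfl, hS.symm, hs⟩
  | head h _ ih =>
    subst hS
    obtain ⟨t, s₁, h₁, ht, rfl, rfl⟩ := h.exists_symAMStep hs
    obtain ⟨t', s', h₂, ht', rfl, rfl, hs'⟩ := ih (h₁.concretePc hs) rfl
    exact ⟨_, s', .head h₁ h₂, pathSat_append.2 ⟨ht, ht'⟩, by simp, rfl, hs'⟩

theorem symInit_pc (p : Program) : (symInit p).regs .pc = .const (some p.entry) := by
  simp [symInit, symSetPc]

/-- An initial configuration is itself a valuation of the symbols, under which the initial symbolic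
configuration evaluates back to it; conversely every valuation evaluates it to an initial
configuration. -/
theorem behaviour_amGen (ω : ℕ) (p : Program) :
    behaviour (amGen ω) p = concretize (symBehaviour ω p) := by
  ext τ
  constructor
  · rintro ⟨σ, hi, c, σ', hs, hf⟩
    -- The program counter is the only register that is not a symbol; its constant is the entry
    -- line, which is also its value in `σ`.
    have hσ : (symInit p).eval ⟨σ.mem, σ.regs⟩ = σ := by
      obtain ⟨m, a⟩ := σ
      simp only [SymConfig.eval, symInit, eval_symSetPc, SymMem.eval, SymExpr.eval, setPc]
      congr
      rw [← hi]
      exact Function.update_eq_self _ _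
    obtain ⟨t, s', h, ht, rfl, hs', hc⟩ := hs.exists_symSteps (μ := ⟨σ.mem, σ.regs⟩)
      (s := [⟨0, symInit p, ⊤⟩]) (by simpa using ⟨_, symInit_pc p⟩) (by simp [SymInst.eval, hσ])
    obtain _ | ⟨⟨c', σs, n⟩, _ | _⟩ := s'
    · simp at hs'
    · simp only [List.map_cons, List.map_nil, SymInst.eval, List.cons.injEq, Inst.mk.injEq,
        and_true] at hs'
      obtain ⟨rfl, rfl, rfl⟩ := hs'
      refine ⟨t, ⟨_, σs, h, ?_⟩, _, ht, rfl⟩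
      have hc : σs.ConcretePc := hc ⟨c, σs, ⊤⟩ (by simp)
      have hf : (σs.eval ⟨σ.mem, σ.regs⟩).regs .pc = none := hf
      exact (hc.pc_eq (μ := ⟨σ.mem, σ.regs⟩)).trans (by rw [hf])
    · simp at hs'
  · rintro ⟨t, ⟨c, σs, hs, hf⟩, μ, ht, rfl⟩
    exact ⟨(symInit p).eval μ, SymConfig.eval_pc (symInit_pc p), c, σs.eval μ, hs.eval ht,
      SymConfig.eval_pc hf⟩

end MuAsm

theorem mainTheorem2 (ω : ℕ) : (MuAsm.specS ω).Secure :=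
  ⟨fun _ pol => MuAsm.sni_oracle_iff pol, MuAsm.behaviour_amGen ω, fun _ =>
    ⟨MuAsm.nspecProject_image_behaviour (fun _ _ h => h.project) fun _ _ h => MuAsm.exists_amGen h,
      fun O => (MuAsm.nspecProject_image_behaviour (fun _ _ h => h.project)
        fun _ _ h => MuAsm.exists_oracleGen h O).symm⟩⟩
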